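/- Let $(M,\lambda,J)$ be a contact triad: $M$ is a smooth manifold of odd dimension, $\lambda$ a contact form with contact distribution $\xi=\ker\lambda$ and Reeb vector field $R_\lambda$, and $J$ an almost complex structure on $\xi$ for which $d\lambda(\cdot,J\cdot)|_\xi$ is a $J$-invariant metric, extended to $TM$ by $JR_\lambda=0$. Let $\Pi:TM\to\xi$, $\Pi Y=Y-\lambda(Y)R_\lambda$, and let $g=d\lambda(\cdot,J\cdot)+\lambda\otimes\lambda$ be the triad metric. Let $\nabla$ be the contact triad connection, i.e. the affine connection on $M$, with torsion $T(X,Y)=\nabla_XY-\nabla_YX-[X,Y]$, such that (1) $\nabla g=0$; (2) $T(R_\lambda,\cdot)=0$; (3) $\nabla_{R_\lambda}R_\lambda=0$ and $\nabla_YR_\lambda\in\xi$ for $Y\in\xi$; (4) $\nabla^\pi:=\Pi\nabla|_\xi$ is a Hermitian connection on $(\xi,d\lambda|_\xi,J)$; (5) $T^\pi:=\Pi T$ satisfies $T^\pi(JY,Y)=0$ for $Y\in\xi$; (6) $\frac12(\nabla_YR_\lambda-J\nabla_{JY}R_\lambda)=0$ for $Y\in\xi$. Let $(\dot\Sigma,j)$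 be a Riemann surface, possibly with boundary, $\gamma$ a smooth one-form on $\dot\Sigma$, and $H:\dot\Sigma\times M\to\mathbb R$ a smooth function. For $z\in\dot\Sigma$ let $X_H(z,\cdot)$ be the contact vector field on $M$ with $-\lambda(X_H(z,\cdot))=H(z,\cdot)$. For a smooth map $u:\dot\Sigma\to M$ write $X_H(u)(z)=X_H(z,u(z))$, $X_H^\pi(u)=\Pi X_H(u)$ and $d_H^\pi u=\Pi(du-X_H(u)\otimes\gamma)$, a one-form with values in $u^*\xi$. For such a one-form $\beta$ put $d^{\nabla^\pi}\beta(V,W)=\nabla^\pi_V(\beta(W))-\nabla^\pi_W(\beta(V))-\beta([V,W])$, where $\nabla^\pi$ also denotes the pull-back connection on $u^*\xi$; and for a real-valued one-form $\alpha$ put $(\alpha\wedge\beta)(V,W)=\alpha(V)\beta(W)-\alpha(W)\beta(V)$. **Theorem (Fundamental equation).** Let $u:\dot\Sigma\to M$ be an $H$-perturbed contact Cauchy--Riemann map, i.e. a smooth map with $$(du-X_H(u)\otimes\gamma)^{\pi(0,1)}=\tfrac12\left(d_H^\pi u+J\circ d_H^\pi u\circ j\right)=0 .$$ Then, as two-forms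 on $\dot\Sigma$ with values in $u^*\xi$, $$ \begin{aligned} d^{\nabla^\pi}(d_H^\pi u)={}& u^*\lambda\wedge\left(\tfrac12(\mathcal L_{R_\lambda}J)J\,d_H^\pi u\right)+T^\pi\left(X_H^\pi(u),\,\gamma\wedge d_H^\pi u\right)\\ &+u^*\lambda\wedge\left(\tfrac12(\mathcal L_{R_\lambda}J)J\,X_H^\pi(u)\otimes\gamma\right)-d^{\nabla^\pi}\left(X_H^\pi(u)\otimes\gamma\right). \end{aligned} $$ -/

import Mathlib

open Bundle FiberBundle VectorField
open scoped Manifold ContDiff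

noncomputable section

namespace ContactCR

/-! ### One-forms, vector fields and endomorphism fields -/

section Tensors

variable {E : Type*} [NormedAddCommGroup E] [NormedSpace ℝ E]
  {H : Type*} [TopologicalSpace H] (I : ModelWithCorners ℝ E H)
  {M : Type*} [TopologicalSpace M] [ChartedSpace H M] [IsManifold I ∞ M]

/-- Smoothness of a vector field, as a section of the tangent bundle. -/
def SmoothVectorField (Y : Π p : M, TangentSpace I p) : Prop :=
  ContMDiff I (I.prod 𝓘(ℝ, E)) ∞ (fun p : M => (⟨p, Y p⟩ : TangentBundle I M))

/-- Differentiability of a vector field at a point. -/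
def VectorFieldDiffAt (Y : Π p : M, TangentSpace I p) (p : M) : Prop :=
  MDifferentiableAt I (I.prod 𝓘(ℝ, E)) (fun q : M => (⟨q, Y q⟩ : TangentBundle I M)) p

/-- Smoothness of a one-form: it is a smooth function on the total space of the tangent bundle. -/
def SmoothOneForm (α : Π p : M, TangentSpace I p →L[ℝ] ℝ) : Prop :=
  ContMDiff (I.prod 𝓘(ℝ, E)) 𝓘(ℝ, ℝ) ∞ (fun v : TangentBundle I M => α v.1 v.2)

/-- Smoothness of a field of endomorphisms of the tangent bundle: it is a smooth self-map of the
total space. -/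
def SmoothEndomorphism (A : Π p : M, TangentSpace I p →L[ℝ] TangentSpace I p) : Prop :=
  ContMDiff (I.prod 𝓘(ℝ, E)) (I.prod 𝓘(ℝ, E)) ∞
    (fun v : TangentBundle I M => (⟨v.1, A v.1 v.2⟩ : TangentBundle I M))

/-- The differential of a real function at a point, as a real-valued linear form. -/
def differential (f : M → ℝ) (p : M) : TangentSpace I p →L[ℝ] ℝ :=
  mfderiv I 𝓘(ℝ, ℝ) f p

/-- Exterior derivative of a one-form, `dα(v, w) = V(α(W)) - W(α(V)) - α([V, W])`, where `V`, `W`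
are the local extensions of `v`, `w` with constant coefficients in the chart at `p`
(the value depends on `v` and `w` only). -/
def dForm (α : Π p : M, TangentSpace I p →L[ℝ] ℝ) (p : M) (v w : TangentSpace I p) : ℝ :=
  differential I (fun q => α q (extend E w q)) p v
    - differential I (fun q => α q (extend E v q)) p w
    - α p (mlieBracket I (extend E v) (extend E w) p)

/-- Lie derivative of an endomorphism field along a vector field,
`(L_X A) v = [X, A V] - A [X, V]` for a local extension `V` of `v`
(the value depends on `v` only). -/
def lieDerivEnd (X : Π p : M, TangentSpace I p)
    (A : Π p : M, TangentSpace I p →L[ℝ] TangentSpace I p) (p : M) (v : TangentSpace I p) :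
    TangentSpace I p :=
  mlieBracket I X (fun q => A q (extend E v q)) p - A p (mlieBracket I X (extend E v) p)

/-- An almost complex structure: a smooth field `j` of endomorphisms with `j² = -1`.
On a surface this is the same as a complex structure. -/
structure AlmostComplexStructure (M : Type*) [TopologicalSpace M] [ChartedSpace H M]
    [IsManifold I ∞ M] where
  j : Π p : M, TangentSpace I p →L[ℝ] TangentSpace I p
  smooth : SmoothEndomorphism I j
  sq : ∀ p (v : TangentSpace I p), j p (j p v) = -v

end Tensors

/-! ### Contact triads -/

section Contact

variable (E : Type*) [NormedAddCommGroup E] [NormedSpace ℝ E]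
  (M : Type*) [TopologicalSpace M] [ChartedSpace E M] [IsManifold 𝓘(ℝ, E) ∞ M]

/-- A contact triad `(M, λ, J)`: a contact form `λ` with contact distribution `ξ = ker λ`, its Reeb
vector field, and a `CR`-almost complex structure `J` on `ξ` adapted to `λ`, extended to the tangent
bundle by `J R = 0`. (Nondegeneracy of `dλ` on `ξ` forces the dimension to be odd.) -/
structure ContactTriad where
  /-- The contact form. -/
  form : Π p : M, TangentSpace 𝓘(ℝ, E) p →L[ℝ] ℝ
  smooth_form : SmoothOneForm 𝓘(ℝ, E) form
  nondegenerate : ∀ (p : M) (v : TangentSpace 𝓘(ℝ, E) p), form p v = 0 →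
    (∀ w : TangentSpace 𝓘(ℝ, E) p, form p w = 0 → dForm 𝓘(ℝ, E) form p v w = 0) → v = 0
  /-- The Reeb vector field. -/
  reeb : Π p : M, TangentSpace 𝓘(ℝ, E) p
  smooth_reeb : SmoothVectorField 𝓘(ℝ, E) reeb
  form_reeb : ∀ p : M, form p (reeb p) = 1
  dForm_reeb : ∀ (p : M) (v : TangentSpace 𝓘(ℝ, E) p),
    dForm 𝓘(ℝ, E) form p (reeb p) v = 0
  /-- The `CR`-almost complex structure. -/
  J : Π p : M, TangentSpace 𝓘(ℝ, E) p →L[ℝ] TangentSpace 𝓘(ℝ, E) p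
  smooth_J : SmoothEndomorphism 𝓘(ℝ, E) J
  J_reeb : ∀ p : M, J p (reeb p) = 0
  form_J : ∀ (p : M) (v : TangentSpace 𝓘(ℝ, E) p), form p (J p v) = 0
  J_sq : ∀ (p : M) (v : TangentSpace 𝓘(ℝ, E) p), form p v = 0 → J p (J p v) = -v
  compatible : ∀ (p : M) (v w : TangentSpace 𝓘(ℝ, E) p), form p v = 0 → form p w = 0 →
    dForm 𝓘(ℝ, E) form p (J p v) (J p w) = dForm 𝓘(ℝ, E) form p v w
  positive : ∀ (p : M) (v : TangentSpace 𝓘(ℝ, E) p), form p v = 0 → v ≠ 0 →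
    0 < dForm 𝓘(ℝ, E) form p v (J p v)

variable {E M}

namespace ContactTriad

variable (T : ContactTriad E M)

/-- The projection `Π` of the tangent space onto `ξ` along the Reeb direction,
`Π v = v - λ(v) R`. -/
def proj (p : M) : TangentSpace 𝓘(ℝ, E) p →L[ℝ] TangentSpace 𝓘(ℝ, E) p :=
  ContinuousLinearMap.id ℝ (TangentSpace 𝓘(ℝ, E) p) - (T.form p).smulRight (T.reeb p)

/-- The contact triad metric `g = dλ(·, J ·) + λ ⊗ λ`. -/
def metric (p : M) (v w : TangentSpace 𝓘(ℝ, E) p) : ℝ :=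
  dForm 𝓘(ℝ, E) T.form p v (T.J p w) + T.form p v * T.form p w

/-- The vector field `Y` is a section of the contact distribution. -/
def IsHorizontal (Y : Π p : M, TangentSpace 𝓘(ℝ, E) p) : Prop :=
  ∀ p, T.form p (Y p) = 0

/-- `X` is the contact Hamiltonian vector field of the function `h`: a smooth vector field which is
contact, that is `[X, Γ(ξ)] ⊆ Γ(ξ)`, and whose contact Hamiltonian `-λ(X)` is `h`. -/
structure IsContactHamiltonianVectorField (h : M → ℝ) (X : Π p : M, TangentSpace 𝓘(ℝ, E) p) :
    Prop where
  smooth : SmoothVectorField 𝓘(ℝ, E) X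
  contact : ∀ (Y : Π p : M, TangentSpace 𝓘(ℝ, E) p) (p : M), T.IsHorizontal Y →
    VectorFieldDiffAt 𝓘(ℝ, E) Y p → T.form p (mlieBracket 𝓘(ℝ, E) X Y p) = 0
  hamiltonian : ∀ p, -T.form p (X p) = h p

variable [FiniteDimensional ℝ E]

/-- The `ξ`-projection `T^π = Π T` of the torsion of an affine connection. -/
def torsionPi (cov : CovariantDerivative 𝓘(ℝ, E) E (TangentSpace 𝓘(ℝ, E) : M → Type _)) (p : M)
    (v w : TangentSpace 𝓘(ℝ, E) p) : TangentSpace 𝓘(ℝ, E) p :=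
  T.proj p (cov.torsion p v w)

/-- The defining properties of the contact triad connection of a contact triad.
Here `cov Y p v` is `∇_v Y` at `p`. -/
structure IsContactTriadConnection
    (cov : CovariantDerivative 𝓘(ℝ, E) E (TangentSpace 𝓘(ℝ, E) : M → Type _)) : Prop where
  smooth : cov.ContMDiffCovariantDerivative ∞
  /-- `∇` is metric with respect to the triad metric. -/
  metric : ∀ (Y Z : Π p : M, TangentSpace 𝓘(ℝ, E) p) (p : M) (v : TangentSpace 𝓘(ℝ, E) p),
    VectorFieldDiffAt 𝓘(ℝ, E) Y p → VectorFieldDiffAt 𝓘(ℝ, E) Z p →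
    differential 𝓘(ℝ, E) (fun q => T.metric q (Y q) (Z q)) p v
      = T.metric p (cov Y p v) (Z p) + T.metric p (Y p) (cov Z p v)
  /-- `T(R, ·) = 0`. -/
  torsion_reeb : ∀ (p : M) (v : TangentSpace 𝓘(ℝ, E) p), cov.torsion p (T.reeb p) v = 0
  /-- `∇_R R = 0`. -/
  reeb_reeb : ∀ p : M, cov T.reeb p (T.reeb p) = 0
  /-- `∇_Y R ∈ ξ` for `Y ∈ ξ`. -/
  form_reeb : ∀ (p : M) (v : TangentSpace 𝓘(ℝ, E) p), T.form p v = 0 →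
    T.form p (cov T.reeb p v) = 0
  /-- `∇^π = Π ∇|_ξ` is Hermitian on `(ξ, dλ|_ξ, J)`: it preserves `dλ|_ξ` ... -/
  hermitian_form : ∀ (Y Z : Π p : M, TangentSpace 𝓘(ℝ, E) p) (p : M)
    (v : TangentSpace 𝓘(ℝ, E) p), T.IsHorizontal Y → T.IsHorizontal Z →
    VectorFieldDiffAt 𝓘(ℝ, E) Y p → VectorFieldDiffAt 𝓘(ℝ, E) Z p →
    differential 𝓘(ℝ, E) (fun q => dForm 𝓘(ℝ, E) T.form q (Y q) (Z q)) p v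
      = dForm 𝓘(ℝ, E) T.form p (T.proj p (cov Y p v)) (Z p)
        + dForm 𝓘(ℝ, E) T.form p (Y p) (T.proj p (cov Z p v))
  /-- ... and it is `J`-linear. -/
  hermitian_J : ∀ (Y : Π p : M, TangentSpace 𝓘(ℝ, E) p) (p : M) (v : TangentSpace 𝓘(ℝ, E) p),
    T.IsHorizontal Y → VectorFieldDiffAt 𝓘(ℝ, E) Y p →
    T.proj p (cov (fun q => T.J q (Y q)) p v) = T.J p (T.proj p (cov Y p v))
  /-- `T^π(JY, Y) = 0` for `Y ∈ ξ`. -/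
  torsion_J : ∀ (p : M) (v : TangentSpace 𝓘(ℝ, E) p), T.form p v = 0 →
    T.torsionPi cov p (T.J p v) v = 0
  /-- `(∇_Y R - J ∇_{JY} R) / 2 = 0` for `Y ∈ ξ`. -/
  reeb_linear_part : ∀ (p : M) (v : TangentSpace 𝓘(ℝ, E) p), T.form p v = 0 →
    (1 / 2 : ℝ) • (cov T.reeb p v - T.J p (cov T.reeb p (T.J p v))) = 0

end ContactTriad

end Contact

/-! ### Forms along a map with values in the pulled back tangent bundle -/

section Along

variable {E : Type*} [NormedAddCommGroup E] [NormedSpace ℝ E]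
  {H : Type*} [TopologicalSpace H] (I : ModelWithCorners ℝ E H)
  {S : Type*} [TopologicalSpace S] [ChartedSpace H S]
  {F : Type*} [NormedAddCommGroup F] [NormedSpace ℝ F]
  {M : Type*} [TopologicalSpace M] [ChartedSpace F M] [IsManifold 𝓘(ℝ, F) ∞ M]

/-- One-forms on `S` with values in `u^*TM`. -/
abbrev OneFormAlong (u : S → M) : Type _ :=
  Π z : S, TangentSpace I z →L[ℝ] TangentSpace 𝓘(ℝ, F) (u z)

/-- The differential `du` as a one-form with values in `u^*TM`. -/
def du (u : S → M) : OneFormAlong (F := F) I u :=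
  fun z => mfderiv I 𝓘(ℝ, F) u z

/-- The one-form `Y ⊗ γ`, for a vector field `Y` along `u` and a scalar one-form `γ`. -/
def tensorForm {u : S → M} (Y : Π z : S, TangentSpace 𝓘(ℝ, F) (u z))
    (γ : Π z : S, TangentSpace I z →L[ℝ] ℝ) : OneFormAlong (F := F) I u :=
  fun z => (γ z).smulRight (Y z)

/-- The wedge product at a point of a scalar-valued and a vector-valued linear map:
`(α ∧ β)(v, w) = α(v) β(w) - α(w) β(v)`. -/
def wedge {V W : Type*} [AddCommGroup W] [Module ℝ W] (α : V → ℝ) (β : V → W) (v w : V) : W :=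
  α v • β w - α w • β v

/-- The pull-back connection `u^*∇` on `u^*TM`. For a section `s` of `u^*TM`, written in the
trivialization of `TM` at `u z` as `s = ∑ sⁱ eᵢ ∘ u`, this is
`(u^*∇)_v s = ∑ dsⁱ(v) eᵢ + sⁱ(z) ∇_{du(v)} eᵢ`, and `∑ sⁱ(z) eᵢ` is the extension of `s z` with
constant coefficients in that trivialization. -/
def pullbackCov (cov : CovariantDerivative 𝓘(ℝ, F) F (TangentSpace 𝓘(ℝ, F) : M → Type _))
    (u : S → M) (s : Π z : S, TangentSpace 𝓘(ℝ, F) (u z)) (z : S) (v : TangentSpace I z) :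
    TangentSpace 𝓘(ℝ, F) (u z) :=
  let t := trivializationAt F (TangentSpace 𝓘(ℝ, F) : M → Type _) (u z)
  let coeff : S → F := fun z' => (t (⟨u z', s z'⟩ : TangentBundle 𝓘(ℝ, F) M)).2
  t.symm (u z) (mfderiv I 𝓘(ℝ, F) coeff z v)
    + cov (extend F (s z)) (u z) (du (F := F) I u z v)

variable (T : ContactTriad F M)

/-- The pull-back to `u^*ξ` of the contact Hermitian connection `∇^π = Π ∇|_ξ`. -/
def pullbackCovPi (cov : CovariantDerivative 𝓘(ℝ, F) F (TangentSpace 𝓘(ℝ, F) : M → Type _))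
    (u : S → M) (s : Π z : S, TangentSpace 𝓘(ℝ, F) (u z)) (z : S) (v : TangentSpace I z) :
    TangentSpace 𝓘(ℝ, F) (u z) :=
  T.proj (u z) (pullbackCov I cov u s z v)

/-- The covariant exterior derivative `d^{∇^π} β` of a `u^*ξ`-valued one-form `β`, evaluated at `z`
on vector fields `V`, `W` of `S`:
`d^{∇^π} β (V, W) = ∇^π_V (β(W)) - ∇^π_W (β(V)) - β([V, W])`. -/
def extCovDerivPi (cov : CovariantDerivative 𝓘(ℝ, F) F (TangentSpace 𝓘(ℝ, F) : M → Type _))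
    (u : S → M) (β : OneFormAlong (F := F) I u) (V W : Π z : S, TangentSpace I z) (z : S) :
    TangentSpace 𝓘(ℝ, F) (u z) :=
  pullbackCovPi I T cov u (fun z' => β z' (W z')) z (V z)
    - pullbackCovPi I T cov u (fun z' => β z' (V z')) z (W z)
    - β z (mlieBracket I V W z)

/-- The horizontal part `X^π(u)` of a domain-dependent vector field `X` along `u`. -/
def horizontalAlong (u : S → M) (X : S → Π p : M, TangentSpace 𝓘(ℝ, F) p) (z : S) :
    TangentSpace 𝓘(ℝ, F) (u z) :=
  T.proj (u z) (X z (u z))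

/-- `d_H^π u = Π (du - X_H(u) ⊗ γ)`. -/
def dHPi (u : S → M) (X : S → Π p : M, TangentSpace 𝓘(ℝ, F) p)
    (γ : Π z : S, TangentSpace I z →L[ℝ] ℝ) : OneFormAlong (F := F) I u :=
  fun z => (T.proj (u z)).comp
    (du (F := F) I u z - tensorForm I (fun z' => X z' (u z')) γ z)

/-- The perturbed contact Cauchy-Riemann equation `(du - X_H(u) ⊗ γ)^{π(0,1)} = 0`, where
`β^{(0,1)} = (β + J ∘ β ∘ j) / 2`. -/
def IsPerturbedCR [IsManifold I ∞ S] (j : AlmostComplexStructure I S) (u : S → M)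
    (X : S → Π p : M, TangentSpace 𝓘(ℝ, F) p) (γ : Π z : S, TangentSpace I z →L[ℝ] ℝ) : Prop :=
  ∀ (z : S) (v : TangentSpace I z),
    (1 / 2 : ℝ) • (dHPi I T u X γ z v + T.J (u z) (dHPi I T u X γ z (j.j z v))) = 0

/-- The pull-back one-form `u^*λ`. -/
def pullbackForm (u : S → M) (z : S) (v : TangentSpace I z) : ℝ :=
  T.form (u z) (du (F := F) I u z v)

/-- The endomorphism `½ (L_R J) J`. -/
def halfLieJJ (p : M) (v : TangentSpace 𝓘(ℝ, F) p) : TangentSpace 𝓘(ℝ, F) p :=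
  (1 / 2 : ℝ) • lieDerivEnd 𝓘(ℝ, F) T.reeb T.J p (T.J p v)

end Along

end ContactCR

end

noncomputable section

set_option linter.unusedSectionVars false

namespace ContactCR

/-! ### Differential of a vector-valued function on a Lie bracket, on manifolds with boundary. -/

section Bracket

open Set Filter
open scoped Topology

variable {E : Type*} [NormedAddCommGroup E] [NormedSpace ℝ E]
  {B : Type*} [TopologicalSpace B] {I : ModelWithCorners ℝ E B}
  {S : Type*} [TopologicalSpace S] [ChartedSpace B S]
  {G : Type*} [NormedAddCommGroup G] [NormedSpace ℝ G]

/-! By definition `Π du = d_H^π u + X_H^π(u) ⊗ γ`, so once the last term is moved to the left the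
theorem computes `d^{∇^π}(Π du)`, with `Π du = du - u^*λ ⊗ R`.

The torsion identity for the pull-back connection (`pullbackCov_mfderiv_sub`) says `d^∇ du = T(du,
du)`. After projection this is `T^π(Π du, Π du)`, because `T(R, ·) = 0`. Differentiating `λ(du W) R`
leaves only `λ(du W) ∇_{du V} R` after projection, since `Π R = 0` kills the derivative of the
coefficient; as `∇_R R = 0`, only `Π du V` matters. Hence `d^{∇^π}(Π du) = T^π(Π du, Π du) + u^*λ ∧
∇_{Π du} R`.

Two inputs finish the proof. On `ξ` one has `∇R = ½ (L_R J) J` (`halfLieJJ_eq`), which gives both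
wedge terms with `u^*λ`. In the expansion of `T^π(Π du, Π du)` the part quadratic in `d_H^π u`
vanishes (`torsionPi_dHPi`): the Cauchy-Riemann equation puts the image of `d_H^π u` in one
`J`-complex line, where `T^π(JY, Y) = 0` applies. The part quadratic in `X_H^π(u)` vanishes by
antisymmetry, and the mixed part is `T^π(X_H^π(u), γ ∧ d_H^π u)`.

One analytic point remains. The fields `X z` are assumed smooth only for each fixed `z`, while the
Leibniz rule needs `X_H^π(u)` to be differentiable along the surface. Smoothness of `H` in both
variables yields this (`alongDiffAt_horizontalAlong`), since `X_H^π(u)` solves a nondegenerate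
linear system with differentiable coefficients. -/

theorem mvfderiv_eq_fderivWithin_comp_extChartAt_symm [IsManifold I 1 S] {f : S → G} {z z' : S}
    (hz' : z' ∈ (extChartAt I z).source) (hf : MDifferentiableAt I 𝓘(ℝ, G) f z')
    (v : TangentSpace I z') :
    mvfderiv I f z' v = fderivWithin ℝ (f ∘ (extChartAt I z).symm) (range I) (extChartAt I z z')
      (mvfderiv I (extChartAt I z) z' v) := by
  have hy : extChartAt I z z' ∈ (extChartAt I z).target := (extChartAt I z).map_source hz'
  have hsymm : (extChartAt I z).symm (extChartAt I z z') = z' := (extChartAt I z).left_inv hz'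
  have h1 : mfderivWithin 𝓘(ℝ, E) 𝓘(ℝ, G) (f ∘ (extChartAt I z).symm) (range I)
      (extChartAt I z z') = (mfderiv I 𝓘(ℝ, G) f z').comp
        (mfderivWithin 𝓘(ℝ, E) I (extChartAt I z).symm (range I) (extChartAt I z z')) := by
    apply mfderiv_comp_mfderivWithin_of_eq hf (mdifferentiableWithinAt_extChartAt_symm hy) _ hsymm
    exact (I.uniqueDiffOn _ (extChartAt_target_subset_range z hy)).uniqueMDiffWithinAt
  have h2 := mfderivWithin_extChartAt_symm_comp_mfderiv_extChartAt' (I := I) hz'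
  rw [mfderivWithin_eq_fderivWithin] at h1
  have h3 := congrArg (fun L => L (mfderiv I 𝓘(ℝ, E) (extChartAt I z) z' v)) h1
  refine Eq.trans ?_ h3.symm
  have h4 := congrArg (fun L => (mfderiv I 𝓘(ℝ, G) f z') (L v)) h2
  exact h4.symm

/-- The coordinate expression of a vector field in the chart at `z`. -/
def chartField (I : ModelWithCorners ℝ E B) (z : S) (U : Π z : S, TangentSpace I z) : E → E :=
  fun y => mpullbackWithin 𝓘(ℝ, E) I (extChartAt I z).symm U (range I) y

theorem chartField_apply [IsManifold I 1 S] (z : S)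
    (U : Π z : S, TangentSpace I z) {y : E} (hy : y ∈ (extChartAt I z).target) :
    chartField I z U y =
      mvfderiv I (extChartAt I z) ((extChartAt I z).symm y)
        (U ((extChartAt I z).symm y)) := by
  have h1 := mfderivWithin_extChartAt_symm_comp_mfderiv_extChartAt (I := I) hy
  have h2 := mfderiv_extChartAt_comp_mfderivWithin_extChartAt_symm (I := I) hy
  have : (mfderivWithin 𝓘(ℝ, E) I (extChartAt I z).symm (range I) y).inverse =
      mfderiv I 𝓘(ℝ, E) (extChartAt I z) ((extChartAt I z).symm y) :=
    ContinuousLinearMap.inverse_eq h1 h2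
  simp only [chartField, mpullbackWithin_apply]
  rw [this]
  rfl

theorem contDiffWithinAt_comp_extChartAt_symm {n : WithTop ℕ∞} {f : S → G} {z : S}
    (hf : ContMDiffAt I 𝓘(ℝ, G) n f z) :
    ContDiffWithinAt ℝ n (f ∘ (extChartAt I z).symm) (range I) (extChartAt I z z) := by
  simpa only [extChartAt_model_space_eq_id, PartialEquiv.refl_coe, Function.id_comp]
    using (contMDiffAt_iff.1 hf).2

theorem mvfderiv_apply_comp_extChartAt_symm_eventuallyEq [IsManifold I ∞ S] {f : S → G} {z : S}
    (hf : ContMDiffAt I 𝓘(ℝ, G) 2 f z) (U : Π z : S, TangentSpace I z) :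
    ((fun z' => mvfderiv I f z' (U z')) ∘ (extChartAt I z).symm)
      =ᶠ[𝓝[range I] (extChartAt I z z)] fun y =>
        fderivWithin ℝ (f ∘ (extChartAt I z).symm) (range I) y
          (chartField I z U y) := by
  have : IsManifold I 2 S := .of_le (n := ∞) (by norm_cast)
  have hev : ∀ᶠ y in 𝓝 (extChartAt I z z),
      ContMDiffAt I 𝓘(ℝ, G) 2 f ((extChartAt I z).symm y) := by
    have h := (contMDiffAt_iff_contMDiffAt_nhds (by simp)).1 hf
    rw [← extChartAt_to_inv (I := I) z] at h
    exact (continuousAt_extChartAt_symm z).eventually h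
  filter_upwards [extChartAt_target_mem_nhdsWithin (I := I) z, nhdsWithin_le_nhds hev]
    with y hy hfy
  rw [chartField_apply z U hy, Function.comp_apply,
    mvfderiv_eq_fderivWithin_comp_extChartAt_symm ((extChartAt I z).map_target hy)
      (hfy.mdifferentiableAt two_ne_zero), (extChartAt I z).right_inv hy]

theorem VectorFieldDiffAt.differentiableWithinAt_chartField [IsManifold I ∞ S]
    [CompleteSpace E] {z : S} {U : Π z : S, TangentSpace I z} (hU : VectorFieldDiffAt I U z) :
    DifferentiableWithinAt ℝ
      (chartField I z U)
      (range I) (extChartAt I z z) := by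
  have : IsManifold I 2 S := .of_le (n := ∞) (by norm_cast)
  have h := (MDifferentiableAt.mdifferentiableWithinAt hU (s := univ))
    |>.differentiableWithinAt_mpullbackWithin_vectorField
  rw [preimage_univ, univ_inter] at h
  exact h

theorem differentiableWithinAt_fderivWithin_comp_extChartAt_symm {f : S → G} {z : S}
    (hf : ContMDiffAt I 𝓘(ℝ, G) 2 f z) :
    DifferentiableWithinAt ℝ (fderivWithin ℝ (f ∘ (extChartAt I z).symm) (range I)) (range I)
      (extChartAt I z z) :=
  ((contDiffWithinAt_comp_extChartAt_symm hf).fderivWithin_right (m := 1) I.uniqueDiffOn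
    (by norm_num) (extChartAt_target_subset_range z (mem_extChartAt_target z))).differentiableWithinAt one_ne_zero

theorem mdifferentiableAt_mvfderiv_apply [IsManifold I ∞ S] [CompleteSpace E] {f : S → G} {z : S}
    (hf : ContMDiffAt I 𝓘(ℝ, G) 2 f z)
    {U : Π z : S, TangentSpace I z} (hU : VectorFieldDiffAt I U z) :
    MDifferentiableAt I 𝓘(ℝ, G) (fun z' => mvfderiv I f z' (U z')) z := by
  rw [← mdifferentiableWithinAt_univ]
  apply DifferentiableWithinAt.mdifferentiableWithinAt_of_comp_extChartAt_symm
  rw [preimage_univ, univ_inter]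
  exact (((differentiableWithinAt_fderivWithin_comp_extChartAt_symm hf).clm_apply
    hU.differentiableWithinAt_chartField).congr_of_eventuallyEq_of_mem
      (mvfderiv_apply_comp_extChartAt_symm_eventuallyEq hf U)
      (extChartAt_target_subset_range z (mem_extChartAt_target z)))

/-- In a chart, the derivative of `Df(U)` in the direction `v` is `Df(DU v) + D²f(v, U)`.
Antisymmetrizing removes the second derivatives and leaves `Df` of the coordinate bracket. For
vector-valued `f` this supplies the symmetry behind the torsion identity. -/
theorem mvfderiv_mlieBracket [IsManifold I ∞ S] [CompleteSpace E] {f : S → G} {z : S}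
    (hf : ContMDiffAt I 𝓘(ℝ, G) 2 f z)
    {V W : Π z : S, TangentSpace I z} (hV : VectorFieldDiffAt I V z)
    (hW : VectorFieldDiffAt I W z) :
    mvfderiv I f z (mlieBracket I V W z) =
      mvfderiv I (fun z' => mvfderiv I f z' (W z')) z (V z)
        - mvfderiv I (fun z' => mvfderiv I f z' (V z')) z (W z) := by
  set φ := extChartAt I z with hφ
  set x₀ := φ z with hx₀
  have hx₀t : x₀ ∈ φ.target := mem_extChartAt_target z
  have hx₀r : x₀ ∈ range I := extChartAt_target_subset_range z hx₀t
  have hu := I.uniqueDiffOn x₀ hx₀r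
  have hval : ∀ U : Π z : S, TangentSpace I z,
      chartField I z U x₀ =
        mvfderiv I φ z (U z) := fun U => by
    rw [chartField_apply z U hx₀t]
    exact congrArg (fun q => mvfderiv I φ q (U q)) (extChartAt_to_inv z)
  have hD := differentiableWithinAt_fderivWithin_comp_extChartAt_symm hf
  have key : ∀ U : Π z : S, TangentSpace I z, VectorFieldDiffAt I U z →
      ∀ v : TangentSpace I z, mvfderiv I (fun z' => mvfderiv I f z' (U z')) z v =
      fderivWithin ℝ (f ∘ φ.symm) (range I) x₀ (fderivWithin ℝ
        (chartField I z U) (range I) x₀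
          (mvfderiv I φ z v))
      + fderivWithin ℝ (fderivWithin ℝ (f ∘ φ.symm) (range I)) (range I) x₀
          (mvfderiv I φ z v) (mvfderiv I φ z (U z)) := by
    intro U hU v
    rw [mvfderiv_eq_fderivWithin_comp_extChartAt_symm (mem_extChartAt_source z)
        (mdifferentiableAt_mvfderiv_apply hf hU),
      (mvfderiv_apply_comp_extChartAt_symm_eventuallyEq hf U).fderivWithin_eq_of_mem hx₀r,
      fderivWithin_clm_apply hu hD hU.differentiableWithinAt_chartField]
    simp only [add_apply, ContinuousLinearMap.comp_apply,
      ContinuousLinearMap.flip_apply]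
    rw [← hval U]
  -- At a boundary point, symmetry of the second derivative within `range I` holds because the point
  -- lies in the closure of the interior.
  have hs := ((contDiffWithinAt_comp_extChartAt_symm hf).isSymmSndFDerivWithinAt (by simp)
    I.uniqueDiffOn (I.range_subset_closure_interior hx₀r) hx₀r).eq
        (mvfderiv I φ z (V z)) (mvfderiv I φ z (W z))
  have hbr : mvfderiv I f z (mlieBracket I V W z) = fderivWithin ℝ (f ∘ φ.symm) (range I) x₀
      (lieBracketWithin ℝ (chartField I z V)
        (chartField I z W) (range I) x₀) := by
    rw [mvfderiv_eq_fderivWithin_comp_extChartAt_symm (mem_extChartAt_source z)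
          (hf.mdifferentiableAt two_ne_zero)]
    congr 1
    rw [← mlieBracketWithin_univ, mlieBracketWithin_apply]
    simp only [preimage_univ, univ_inter]
    exact (isInvertible_mfderiv_extChartAt (mem_extChartAt_source z)).self_apply_inverse _
  rw [hbr, key V hV, key W hW]
  unfold lieBracketWithin
  rw [map_sub, hval, hval, hs]
  abel

end Bracket

/-! ### Linearity, Leibniz rule and chain rule for the pull-back connection. -/

section PullbackConnection

open Set Filter
open scoped Topology

variable {E : Type*} [NormedAddCommGroup E] [NormedSpace ℝ E]
  {B : Type*} [TopologicalSpace B] {I : ModelWithCorners ℝ E B}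
  {S : Type*} [TopologicalSpace S] [ChartedSpace B S]
  {F : Type*} [NormedAddCommGroup F] [NormedSpace ℝ F]
  {M : Type*} [TopologicalSpace M] [ChartedSpace F M] [IsManifold 𝓘(ℝ, F) ∞ M]

/-- The components of a vector field along `u` in the trivialization of the tangent bundle
at `u z`. -/
def coeffAlong (u : S → M) (s : Π z : S, TangentSpace 𝓘(ℝ, F) (u z)) (z : S) : S → F :=
  fun z' => (trivializationAt F (TangentSpace 𝓘(ℝ, F) : M → Type _) (u z)
    (⟨u z', s z'⟩ : TangentBundle 𝓘(ℝ, F) M)).2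

variable (I) in
/-- Differentiability at a point of a vector field along a map. -/
def AlongDiffAt (u : S → M) (s : Π z : S, TangentSpace 𝓘(ℝ, F) (u z)) (z : S) : Prop :=
  MDifferentiableAt I 𝓘(ℝ, F) (coeffAlong u s z) z

/-- The coordinates on the tangent space at `p` given by the trivialization at `p`. -/
def tangentCoord (p : M) : TangentSpace 𝓘(ℝ, F) p ≃L[ℝ] F :=
  (trivializationAt F (TangentSpace 𝓘(ℝ, F) : M → Type _) p).continuousLinearEquivAt ℝ p
    (FiberBundle.mem_baseSet_trivializationAt' p)

variable {u : S → M} {z : S}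

theorem alongDiffAt_iff (hu : MDifferentiableAt I 𝓘(ℝ, F) u z)
    {s : Π z : S, TangentSpace 𝓘(ℝ, F) (u z)} :
    AlongDiffAt I u s z ↔ MDifferentiableAt I 𝓘(ℝ, F).tangent
      (fun z' => (⟨u z', s z'⟩ : TangentBundle 𝓘(ℝ, F) M)) z := by
  rw [mdifferentiableAt_totalSpace]
  exact ⟨fun h => ⟨hu, h⟩, fun h => h.2⟩

theorem pullbackCov_eq
    (cov : CovariantDerivative 𝓘(ℝ, F) F (TangentSpace 𝓘(ℝ, F) : M → Type _))
    (s : Π z : S, TangentSpace 𝓘(ℝ, F) (u z)) (v : TangentSpace I z) :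
    pullbackCov I cov u s z v = (tangentCoord (u z)).symm (mvfderiv I (coeffAlong u s z) z v)
      + cov (extend F (s z)) (u z) (mfderiv I 𝓘(ℝ, F) u z v) := by
  rfl

theorem eventually_mem_baseSet (hu : ContinuousAt u z) :
    ∀ᶠ z' in 𝓝 z, u z' ∈ (trivializationAt F (TangentSpace 𝓘(ℝ, F) : M → Type _) (u z)).baseSet :=
  hu ((trivializationAt F (TangentSpace 𝓘(ℝ, F) : M → Type _) (u z)).open_baseSet.mem_nhds
    (FiberBundle.mem_baseSet_trivializationAt' (u z)))

theorem eventually_mem_baseSet_self (p : M) :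
    ∀ᶠ q in 𝓝 p, q ∈ (trivializationAt F (TangentSpace 𝓘(ℝ, F) : M → Type _) p).baseSet :=
  (trivializationAt F (TangentSpace 𝓘(ℝ, F) : M → Type _) p).open_baseSet.mem_nhds
    (FiberBundle.mem_baseSet_trivializationAt' p)

theorem coeffAlong_add_eventuallyEq (hu : ContinuousAt u z)
    (s s' : Π z : S, TangentSpace 𝓘(ℝ, F) (u z)) :
    coeffAlong u (s + s') z =ᶠ[𝓝 z] coeffAlong u s z + coeffAlong u s' z := by
  filter_upwards [eventually_mem_baseSet (F := F) hu] with z' hz'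
  exact ((trivializationAt F (TangentSpace 𝓘(ℝ, F) : M → Type _) (u z)).linear ℝ hz').map_add _ _

theorem coeffAlong_smul_eventuallyEq (hu : ContinuousAt u z) (f : S → ℝ)
    (s : Π z : S, TangentSpace 𝓘(ℝ, F) (u z)) :
    coeffAlong u (f • s) z =ᶠ[𝓝 z] f • coeffAlong u s z := by
  filter_upwards [eventually_mem_baseSet (F := F) hu] with z' hz'
  exact ((trivializationAt F (TangentSpace 𝓘(ℝ, F) : M → Type _) (u z)).linear ℝ hz').map_smul _ _

theorem AlongDiffAt.add (hu : ContinuousAt u z) {s s' : Π z : S, TangentSpace 𝓘(ℝ, F) (u z)}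
    (hs : AlongDiffAt I u s z) (hs' : AlongDiffAt I u s' z) : AlongDiffAt I u (s + s') z :=
  (MDifferentiableAt.add hs hs').congr_of_eventuallyEq (coeffAlong_add_eventuallyEq hu s s')

theorem AlongDiffAt.smul (hu : ContinuousAt u z) {f : S → ℝ}
    {s : Π z : S, TangentSpace 𝓘(ℝ, F) (u z)} (hf : MDifferentiableAt I 𝓘(ℝ, ℝ) f z)
    (hs : AlongDiffAt I u s z) : AlongDiffAt I u (f • s) z :=
  (MDifferentiableAt.smul hf hs).congr_of_eventuallyEq (coeffAlong_smul_eventuallyEq hu f s)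

theorem mvfderiv_congr {G : Type*} [NormedAddCommGroup G] [NormedSpace ℝ G] {f g : S → G}
    (h : f =ᶠ[𝓝 z] g) (v : TangentSpace I z) : mvfderiv I f z v = mvfderiv I g z v := by
  have := h.mfderiv_eq (I := I) (I' := 𝓘(ℝ, G))
  exact congrArg (fun L : TangentSpace I z →L[ℝ] G => L v) this

theorem mvfderiv_coeffAlong_add (hu : ContinuousAt u z)
    {s s' : Π z : S, TangentSpace 𝓘(ℝ, F) (u z)}
    (hs : AlongDiffAt I u s z) (hs' : AlongDiffAt I u s' z) (v : TangentSpace I z) :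
    mvfderiv I (coeffAlong u (s + s') z) z v =
      mvfderiv I (coeffAlong u s z) z v + mvfderiv I (coeffAlong u s' z) z v := by
  rw [mvfderiv_congr (coeffAlong_add_eventuallyEq hu s s'), mvfderiv_add hs hs']
  rfl

theorem mvfderiv_coeffAlong_smul (hu : ContinuousAt u z) {f : S → ℝ}
    {s : Π z : S, TangentSpace 𝓘(ℝ, F) (u z)} (hf : MDifferentiableAt I 𝓘(ℝ, ℝ) f z)
    (hs : AlongDiffAt I u s z) (v : TangentSpace I z) :
    mvfderiv I (coeffAlong u (f • s) z) z v =
      f z • mvfderiv I (coeffAlong u s z) z v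
        + mvfderiv I f z v • tangentCoord (u z) (s z) := by
  rw [mvfderiv_congr (coeffAlong_smul_eventuallyEq hu f s), mvfderiv_smul hf hs]
  rfl

variable [FiniteDimensional ℝ F]
  (cov : CovariantDerivative 𝓘(ℝ, F) F (TangentSpace 𝓘(ℝ, F) : M → Type _))

theorem extend_mdifferentiableAt {p : M} (v : TangentSpace 𝓘(ℝ, F) p) :
    VectorFieldDiffAt 𝓘(ℝ, F) (extend F v) p :=
  mdifferentiableAt_extend 𝓘(ℝ, F) F v

theorem VectorFieldDiffAt.alongDiffAt_id {σ : Π p : M, TangentSpace 𝓘(ℝ, F) p} {p : M}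
    (hσ : VectorFieldDiffAt 𝓘(ℝ, F) σ p) : AlongDiffAt 𝓘(ℝ, F) id σ p :=
  (alongDiffAt_iff mdifferentiableAt_id).2 hσ

theorem extend_eq {p : M} (v : TangentSpace 𝓘(ℝ, F) p) {q : M}
    (hq : q ∈ (trivializationAt F (TangentSpace 𝓘(ℝ, F) : M → Type _) p).baseSet) :
    (extend F v q : TangentSpace 𝓘(ℝ, F) q) =
      (trivializationAt F (TangentSpace 𝓘(ℝ, F) : M → Type _) p).symmₗ ℝ q (tangentCoord p v) := by
  rw [Bundle.Trivialization.coe_symmₗ _ hq]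
  rfl

theorem extend_add_eventuallyEq {p : M} (v w : TangentSpace 𝓘(ℝ, F) p) :
    ∀ᶠ q in 𝓝 p, (extend F (v + w) q : TangentSpace 𝓘(ℝ, F) q) =
      (extend F v + extend F w : Π q : M, TangentSpace 𝓘(ℝ, F) q) q := by
  filter_upwards [eventually_mem_baseSet_self (F := F) p] with q hq
  rw [Pi.add_apply, extend_eq _ hq, extend_eq _ hq, extend_eq _ hq, map_add, map_add]

theorem extend_smul_eventuallyEq {p : M} (c : ℝ) (v : TangentSpace 𝓘(ℝ, F) p) :
    ∀ᶠ q in 𝓝 p, (extend F (c • v) q : TangentSpace 𝓘(ℝ, F) q) =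
      (c • extend F v : Π q : M, TangentSpace 𝓘(ℝ, F) q) q := by
  filter_upwards [eventually_mem_baseSet_self (F := F) p] with q hq
  rw [Pi.smul_apply, extend_eq _ hq, extend_eq _ hq, map_smul, map_smul]

theorem coeffAlong_extend_eventuallyEq {p : M} (v : TangentSpace 𝓘(ℝ, F) p) :
    coeffAlong (id : M → M) (extend F v : Π q : M, TangentSpace 𝓘(ℝ, F) q) p
      =ᶠ[𝓝 p] fun _ => tangentCoord p v := by
  filter_upwards [eventually_mem_baseSet_self (F := F) p] with q hq
  have h := (trivializationAt F (TangentSpace 𝓘(ℝ, F) : M → Type _) p).apply_mk_symm hq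
    (tangentCoord p v)
  have h' := congrArg Prod.snd h
  exact h'

/-- Both the connection and differentiation of coordinates in the trivialization at `p` satisfy the
Leibniz rule, so their difference `Φ` is tensorial and depends on `σ p` alone. It is then evaluated
on the extension with constant coordinates, whose coordinate derivative is zero. -/
theorem cov_apply_eq {σ : Π p : M, TangentSpace 𝓘(ℝ, F) p} {p : M}
    (hσ : VectorFieldDiffAt 𝓘(ℝ, F) σ p) (w : TangentSpace 𝓘(ℝ, F) p) :
    cov σ p w = (tangentCoord p).symm (mvfderiv 𝓘(ℝ, F) (coeffAlong id σ p) p w)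
      + cov (extend F (σ p)) p w := by
  let Φ : (Π p : M, TangentSpace 𝓘(ℝ, F) p) → TangentSpace 𝓘(ℝ, F) p := fun σ =>
    cov σ p w - (tangentCoord p).symm (mvfderiv 𝓘(ℝ, F) (coeffAlong id σ p) p w)
  have hΦ : TensorialAt 𝓘(ℝ, F) F Φ p :=
    { smul := fun {f σ} hf hσ => by
        have h := congrArg (tangentCoord p).symm (mvfderiv_coeffAlong_smul continuousAt_id hf
          (VectorFieldDiffAt.alongDiffAt_id hσ) w)
        have h' : (tangentCoord p).symm (f p • mvfderiv 𝓘(ℝ, F) (coeffAlong id σ p) p w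
            + mvfderiv 𝓘(ℝ, F) f p w • tangentCoord p (σ p)) =
          f p • (tangentCoord p).symm (mvfderiv 𝓘(ℝ, F) (coeffAlong id σ p) p w)
            + mvfderiv 𝓘(ℝ, F) f p w • σ p := by
          rw [map_add, map_smul, map_smul, ContinuousLinearEquiv.symm_apply_apply]
        simp only [Φ]
        rw [cov.isCovariantDerivativeOn.leibniz hσ hf]
        refine (congrArg (_ - ·) (h.trans h')).trans ?_
        simp only [add_apply, ContinuousLinearMap.smulRight_apply, smul_apply]
        rw [smul_sub]
        abel
      add := fun {σ σ'} hσ hσ' => by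
        have h := congrArg (tangentCoord p).symm (mvfderiv_coeffAlong_add continuousAt_id
          (VectorFieldDiffAt.alongDiffAt_id hσ) (VectorFieldDiffAt.alongDiffAt_id hσ') w)
        simp only [Φ]
        rw [cov.isCovariantDerivativeOn.add hσ hσ']
        refine (congrArg (_ - ·) (h.trans (map_add _ _ _))).trans ?_
        simp only [add_apply]
        abel }
  have h := hΦ.pointwise hσ (extend_mdifferentiableAt (σ p)) (by simp)
  have h0 : mvfderiv 𝓘(ℝ, F) (coeffAlong (id : M → M)
      (extend F (σ p) : Π q : M, TangentSpace 𝓘(ℝ, F) q) p) p w = 0 := by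
    rw [mvfderiv_congr (coeffAlong_extend_eventuallyEq (σ p)), mvfderiv_const]
    rfl
  have h1 : Φ (extend F (σ p)) = cov (extend F (σ p)) p w :=
    (congrArg (_ - ·) ((congrArg (tangentCoord p).symm h0).trans (map_zero _))).trans (sub_zero _)
  rw [← h1, ← h]
  simp only [Φ]
  abel

theorem cov_extend_add {p : M} (v v' w : TangentSpace 𝓘(ℝ, F) p) :
    cov (extend F (v + v')) p w = cov (extend F v) p w + cov (extend F v') p w := by
  have hd := mdifferentiableAt_add_section (extend_mdifferentiableAt v)
    (extend_mdifferentiableAt v')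
  rw [cov.isCovariantDerivativeOn.congr_of_eventuallyEq (extend_mdifferentiableAt (v + v')) hd
    Filter.univ_mem (extend_add_eventuallyEq v v'),
    cov.isCovariantDerivativeOn.add (extend_mdifferentiableAt v)
    (extend_mdifferentiableAt v'), add_apply]

theorem cov_extend_smul {p : M} (c : ℝ) (v w : TangentSpace 𝓘(ℝ, F) p) :
    cov (extend F (c • v)) p w = c • cov (extend F v) p w := by
  have hd := (extend_mdifferentiableAt v).smul_const_section (a := c)
  rw [cov.isCovariantDerivativeOn.congr_of_eventuallyEq (extend_mdifferentiableAt (c • v)) hd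
    Filter.univ_mem (extend_smul_eventuallyEq c v), cov.isCovariantDerivativeOn.smul_const c (extend_mdifferentiableAt v),
    smul_apply]

theorem pullbackCov_add (hu : ContinuousAt u z) {s s' : Π z : S, TangentSpace 𝓘(ℝ, F) (u z)}
    (hs : AlongDiffAt I u s z) (hs' : AlongDiffAt I u s' z) (v : TangentSpace I z) :
    pullbackCov I cov u (s + s') z v = pullbackCov I cov u s z v + pullbackCov I cov u s' z v := by
  rw [pullbackCov_eq, pullbackCov_eq, pullbackCov_eq, mvfderiv_coeffAlong_add hu hs hs',
    map_add, Pi.add_apply, cov_extend_add]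
  abel

theorem pullbackCov_smul (hu : ContinuousAt u z) {f : S → ℝ}
    {s : Π z : S, TangentSpace 𝓘(ℝ, F) (u z)} (hf : MDifferentiableAt I 𝓘(ℝ, ℝ) f z)
    (hs : AlongDiffAt I u s z) (v : TangentSpace I z) :
    pullbackCov I cov u (f • s) z v =
      f z • pullbackCov I cov u s z v + mvfderiv I f z v • s z := by
  rw [pullbackCov_eq, pullbackCov_eq, mvfderiv_coeffAlong_smul hu hf hs, map_add, map_smul,
    map_smul, ContinuousLinearEquiv.symm_apply_apply, Pi.smul_apply', cov_extend_smul, smul_add]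
  abel

theorem alongDiffAt_comp (hu : MDifferentiableAt I 𝓘(ℝ, F) u z)
    {σ : Π p : M, TangentSpace 𝓘(ℝ, F) p} (hσ : VectorFieldDiffAt 𝓘(ℝ, F) σ (u z)) :
    AlongDiffAt I u (fun z' => σ (u z')) z :=
  (alongDiffAt_iff hu).2 (MDifferentiableAt.comp z hσ hu)

/-- `cov_apply_eq` splits `∇σ` exactly as `pullbackCov` splits the derivative along `u`; the
coordinate parts agree by the chain rule. -/
theorem pullbackCov_comp (hu : MDifferentiableAt I 𝓘(ℝ, F) u z)
    {σ : Π p : M, TangentSpace 𝓘(ℝ, F) p} (hσ : VectorFieldDiffAt 𝓘(ℝ, F) σ (u z))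
    (v : TangentSpace I z) :
    pullbackCov I cov u (fun z' => σ (u z')) z v = cov σ (u z) (mfderiv I 𝓘(ℝ, F) u z v) := by
  have h : mvfderiv I (coeffAlong u (fun z' => σ (u z')) z) z v =
      mvfderiv 𝓘(ℝ, F) (coeffAlong id σ (u z)) (u z) (mfderiv I 𝓘(ℝ, F) u z v) :=
    mfderiv_comp_apply z (VectorFieldDiffAt.alongDiffAt_id hσ) hu v
  rw [pullbackCov_eq, cov_apply_eq cov hσ, h]

end PullbackConnection

/-! ### Torsion of the pull-back connection. -/

section PullbackTorsion

open Set Filter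
open scoped Topology

variable {E : Type*} [NormedAddCommGroup E] [NormedSpace ℝ E]
  {B : Type*} [TopologicalSpace B] {I : ModelWithCorners ℝ E B}
  {S : Type*} [TopologicalSpace S] [ChartedSpace B S]
  {F : Type*} [NormedAddCommGroup F] [NormedSpace ℝ F]
  {M : Type*} [TopologicalSpace M] [ChartedSpace F M] [IsManifold 𝓘(ℝ, F) ∞ M]
  {u : S → M} {z : S}

theorem trivializationAt_snd_eq_mvfderiv {p q : M}
    (hq : q ∈ (trivializationAt F (TangentSpace 𝓘(ℝ, F) : M → Type _) p).baseSet)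
    (w : TangentSpace 𝓘(ℝ, F) q) :
    (trivializationAt F (TangentSpace 𝓘(ℝ, F) : M → Type _) p
      (⟨q, w⟩ : TangentBundle 𝓘(ℝ, F) M)).2 = mvfderiv 𝓘(ℝ, F) (extChartAt 𝓘(ℝ, F) p) q w := by
  have h := TangentBundle.continuousLinearMapAt_trivializationAt (I := 𝓘(ℝ, F)) (x₀ := p) hq
  have h1 := congrArg (fun L => L w) h
  refine Eq.trans ?_ h1
  exact (Bundle.Trivialization.continuousLinearMapAt_apply_of_mem ℝ _ hq w).symm

theorem tangentCoord_apply (p : M) (w : TangentSpace 𝓘(ℝ, F) p) :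
    tangentCoord p w = mvfderiv 𝓘(ℝ, F) (extChartAt 𝓘(ℝ, F) p) p w :=
  trivializationAt_snd_eq_mvfderiv (FiberBundle.mem_baseSet_trivializationAt' p) w

theorem mdifferentiableAt_extChartAt_of_mem_baseSet {p q : M}
    (hq : q ∈ (trivializationAt F (TangentSpace 𝓘(ℝ, F) : M → Type _) p).baseSet) :
    MDifferentiableAt 𝓘(ℝ, F) 𝓘(ℝ, F) (extChartAt 𝓘(ℝ, F) p) q :=
  mdifferentiableAt_extChartAt hq

/-- The tangent bundle is trivialized by the derivative of the chart, so the components of `du(W)`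
are the derivatives along `W` of `u` read in the chart. This brings `mvfderiv_mlieBracket` to bear
on them. -/
theorem coeffAlong_mfderiv_eventuallyEq (hu : ContMDiff I 𝓘(ℝ, F) ∞ u)
    (W : Π z : S, TangentSpace I z) :
    coeffAlong u (fun z' => mfderiv I 𝓘(ℝ, F) u z' (W z')) z =ᶠ[𝓝 z]
      fun z' => mvfderiv I (extChartAt 𝓘(ℝ, F) (u z) ∘ u) z' (W z') := by
  filter_upwards [eventually_mem_baseSet (F := F) (hu z).continuousAt] with z' hz'
  refine (trivializationAt_snd_eq_mvfderiv hz' _).trans ?_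
  exact (mfderiv_comp_apply z' (mdifferentiableAt_extChartAt_of_mem_baseSet hz')
    ((hu z').mdifferentiableAt (by simp)) (W z')).symm

theorem contMDiffAt_extChartAt_comp (hu : ContMDiff I 𝓘(ℝ, F) ∞ u) :
    ContMDiffAt I 𝓘(ℝ, F) 2 (extChartAt 𝓘(ℝ, F) (u z) ∘ u) z :=
  ((contMDiffAt_extChartAt (I := 𝓘(ℝ, F)) (n := ∞)).comp z (hu z)).of_le (by norm_cast)

theorem alongDiffAt_mfderiv [IsManifold I ∞ S] [CompleteSpace E] (hu : ContMDiff I 𝓘(ℝ, F) ∞ u)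
    {W : Π z : S, TangentSpace I z} (hW : VectorFieldDiffAt I W z) :
    AlongDiffAt I u (fun z' => mfderiv I 𝓘(ℝ, F) u z' (W z')) z :=
  (mdifferentiableAt_mvfderiv_apply (contMDiffAt_extChartAt_comp hu) hW).congr_of_eventuallyEq
    (coeffAlong_mfderiv_eventuallyEq hu W)

theorem mvfderiv_coeffAlong_mfderiv_sub [IsManifold I ∞ S] [CompleteSpace E]
    (hu : ContMDiff I 𝓘(ℝ, F) ∞ u)
    {V W : Π z : S, TangentSpace I z} (hV : VectorFieldDiffAt I V z)
    (hW : VectorFieldDiffAt I W z) :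
    mvfderiv I (coeffAlong u (fun z' => mfderiv I 𝓘(ℝ, F) u z' (W z')) z) z (V z)
      - mvfderiv I (coeffAlong u (fun z' => mfderiv I 𝓘(ℝ, F) u z' (V z')) z) z (W z)
      = tangentCoord (u z) (mfderiv I 𝓘(ℝ, F) u z (mlieBracket I V W z)) := by
  rw [mvfderiv_congr (coeffAlong_mfderiv_eventuallyEq hu W),
    mvfderiv_congr (coeffAlong_mfderiv_eventuallyEq hu V),
    ← mvfderiv_mlieBracket (contMDiffAt_extChartAt_comp hu) hV hW, tangentCoord_apply]
  exact mfderiv_comp_apply z (mdifferentiableAt_extChartAt_of_mem_baseSet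
    (FiberBundle.mem_baseSet_trivializationAt' (u z)))
    ((hu z).mdifferentiableAt (by simp)) _

variable [FiniteDimensional ℝ F]

theorem mlieBracket_extend {p : M} (v w : TangentSpace 𝓘(ℝ, F) p) :
    mlieBracket 𝓘(ℝ, F) (extend F v) (extend F w) p = 0 := by
  have : CompleteSpace F := FiniteDimensional.complete ℝ F
  have hconst : ∀ v w : TangentSpace 𝓘(ℝ, F) p, mvfderiv 𝓘(ℝ, F) (fun q =>
      mvfderiv 𝓘(ℝ, F) (extChartAt 𝓘(ℝ, F) p) q (extend F v q)) p w = 0 := by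
    intro v w
    have h : (fun q => mvfderiv 𝓘(ℝ, F) (extChartAt 𝓘(ℝ, F) p) q (extend F v q))
        =ᶠ[𝓝 p] fun _ => tangentCoord p v := by
      filter_upwards [eventually_mem_baseSet_self (F := F) p, coeffAlong_extend_eventuallyEq v]
        with q hq hv
      exact (trivializationAt_snd_eq_mvfderiv hq _).symm.trans hv
    rw [mvfderiv_congr h, mvfderiv_const]
    rfl
  apply (tangentCoord p).injective
  rw [map_zero, tangentCoord_apply, mvfderiv_mlieBracket
    ((contMDiffAt_extChartAt (n := ∞)).of_le (by norm_cast))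
    (extend_mdifferentiableAt v) (extend_mdifferentiableAt w), hconst, hconst, sub_zero]

/-- The torsion identity for the pull-back connection. -/
theorem pullbackCov_mfderiv_sub [IsManifold I ∞ S] [CompleteSpace E]
    (cov : CovariantDerivative 𝓘(ℝ, F) F (TangentSpace 𝓘(ℝ, F) : M → Type _))
    (hu : ContMDiff I 𝓘(ℝ, F) ∞ u)
    {V W : Π z : S, TangentSpace I z} (hV : VectorFieldDiffAt I V z)
    (hW : VectorFieldDiffAt I W z) :
    pullbackCov I cov u (fun z' => mfderiv I 𝓘(ℝ, F) u z' (W z')) z (V z)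
      - pullbackCov I cov u (fun z' => mfderiv I 𝓘(ℝ, F) u z' (V z')) z (W z)
      = cov.torsion (u z) (mfderiv I 𝓘(ℝ, F) u z (V z)) (mfderiv I 𝓘(ℝ, F) u z (W z))
        + mfderiv I 𝓘(ℝ, F) u z (mlieBracket I V W z) := by
  have h := mvfderiv_coeffAlong_mfderiv_sub hu hV hW
  have h' := congrArg (tangentCoord (u z)).symm h
  rw [map_sub, ContinuousLinearEquiv.symm_apply_apply] at h'
  -- The coordinate parts contribute `du([V, W])`. The connection parts are the torsion of the
  -- constant-coefficient extensions, whose own bracket is zero.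
  rw [pullbackCov_eq, pullbackCov_eq, cov.torsion_apply_eq_extend, extend_apply_self,
    extend_apply_self, ← h', mlieBracket_extend]
  abel

end PullbackTorsion

/-! ### Tensoriality of the exterior derivative of a one-form. -/

section ExteriorDerivative

open Set Filter
open scoped Topology

variable {F : Type*} [NormedAddCommGroup F] [NormedSpace ℝ F] [FiniteDimensional ℝ F]
  {M : Type*} [TopologicalSpace M] [ChartedSpace F M] [IsManifold 𝓘(ℝ, F) ∞ M]

theorem SmoothOneForm.mdifferentiableAt_apply {α : Π p : M, TangentSpace 𝓘(ℝ, F) p →L[ℝ] ℝ}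
    (hα : SmoothOneForm 𝓘(ℝ, F) α) {Y : Π p : M, TangentSpace 𝓘(ℝ, F) p} {p : M}
    (hY : VectorFieldDiffAt 𝓘(ℝ, F) Y p) :
    MDifferentiableAt 𝓘(ℝ, F) 𝓘(ℝ, ℝ) (fun q => α q (Y q)) p :=
  ((hα _).mdifferentiableAt (by simp)).comp p hY

/-- The expression defining the exterior derivative of a one-form, on arbitrary vector fields. -/
def dFormField (α : Π p : M, TangentSpace 𝓘(ℝ, F) p →L[ℝ] ℝ)
    (Y Z : Π p : M, TangentSpace 𝓘(ℝ, F) p) (p : M) : ℝ :=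
  mvfderiv 𝓘(ℝ, F) (fun q => α q (Z q)) p (Y p) - mvfderiv 𝓘(ℝ, F) (fun q => α q (Y q)) p (Z p)
    - α p (mlieBracket 𝓘(ℝ, F) Y Z p)

theorem dFormField_swap (α : Π p : M, TangentSpace 𝓘(ℝ, F) p →L[ℝ] ℝ)
    (Y Z : Π p : M, TangentSpace 𝓘(ℝ, F) p) (p : M) :
    dFormField α Y Z p = -dFormField α Z Y p := by
  rw [dFormField, dFormField, mlieBracket_swap_apply, map_neg]
  ring

theorem tensorialAt_dFormField {α : Π p : M, TangentSpace 𝓘(ℝ, F) p →L[ℝ] ℝ}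
    (hα : SmoothOneForm 𝓘(ℝ, F) α) (Y : Π p : M, TangentSpace 𝓘(ℝ, F) p) (p : M) :
    TensorialAt 𝓘(ℝ, F) F (fun Z => dFormField α Y Z p) p where
  smul {f Z} hf hZ := by
    have : CompleteSpace F := FiniteDimensional.complete ℝ F
    have : IsManifold 𝓘(ℝ, F) 2 M := .of_le (n := ∞) (by norm_cast)
    have h1 : (fun q => α q ((f • Z) q)) = fun q => f q * α q (Z q) := by
      funext q
      exact (α q).map_smul (f q) (Z q)
    simp only [dFormField]
    rw [h1, mvfderiv_fun_mul hf (hα.mdifferentiableAt_apply hZ),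
      mlieBracket_smul_right hf hZ]
    simp
    ring
  add {Z Z'} hZ hZ' := by
    have : CompleteSpace F := FiniteDimensional.complete ℝ F
    have : IsManifold 𝓘(ℝ, F) 2 M := .of_le (n := ∞) (by norm_cast)
    have h1 : (fun q => α q ((Z + Z') q)) = fun q => α q (Z q) + α q (Z' q) := by
      funext q
      exact (α q).map_add (Z q) (Z' q)
    simp only [dFormField]
    rw [h1, mvfderiv_fun_add (hα.mdifferentiableAt_apply hZ) (hα.mdifferentiableAt_apply hZ'),
      mlieBracket_add_right hZ hZ']
    simp
    ring

theorem tensorialAt_dFormField_left {α : Π p : M, TangentSpace 𝓘(ℝ, F) p →L[ℝ] ℝ}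
    (hα : SmoothOneForm 𝓘(ℝ, F) α) (Z : Π p : M, TangentSpace 𝓘(ℝ, F) p) (p : M) :
    TensorialAt 𝓘(ℝ, F) F (fun Y => dFormField α Y Z p) p where
  smul {f Y} hf hY := by
    simp only [dFormField_swap α _ Z]
    rw [(tensorialAt_dFormField hα Z p).smul hf hY, smul_neg]
  add {Y Y'} hY hY' := by
    simp only [dFormField_swap α _ Z]
    rw [(tensorialAt_dFormField hα Z p).add hY hY', neg_add]

/-- The exterior derivative of a smooth one-form as a bilinear form. -/
def dFormHom {α : Π p : M, TangentSpace 𝓘(ℝ, F) p →L[ℝ] ℝ} (hα : SmoothOneForm 𝓘(ℝ, F) α) (p : M) :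
    TangentSpace 𝓘(ℝ, F) p →L[ℝ] TangentSpace 𝓘(ℝ, F) p →L[ℝ] ℝ :=
  TensorialAt.mkHom₂ (fun Y Z => dFormField α Y Z p) p
    (fun Z _ => tensorialAt_dFormField_left hα Z p) (fun Y _ => tensorialAt_dFormField hα Y p)

theorem dForm_eq_dFormHom {α : Π p : M, TangentSpace 𝓘(ℝ, F) p →L[ℝ] ℝ}
    (hα : SmoothOneForm 𝓘(ℝ, F) α) (p : M) (v w : TangentSpace 𝓘(ℝ, F) p) :
    dForm 𝓘(ℝ, F) α p v w = dFormHom hα p v w := by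
  refine Eq.trans ?_ (TensorialAt.mkHom₂_apply_eq_extend _ _ v w).symm
  rw [dFormField, extend_apply_self, extend_apply_self]
  rfl

/-- By tensoriality, the chart-dependent extensions in `dForm` may be replaced by any fields
differentiable at the point. -/
theorem dForm_apply {α : Π p : M, TangentSpace 𝓘(ℝ, F) p →L[ℝ] ℝ}
    (hα : SmoothOneForm 𝓘(ℝ, F) α) {Y Z : Π p : M, TangentSpace 𝓘(ℝ, F) p} {p : M}
    (hY : VectorFieldDiffAt 𝓘(ℝ, F) Y p) (hZ : VectorFieldDiffAt 𝓘(ℝ, F) Z p) :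
    dForm 𝓘(ℝ, F) α p (Y p) (Z p) = dFormField α Y Z p :=
  (dForm_eq_dFormHom hα p _ _).trans (TensorialAt.mkHom₂_apply _ _ hY hZ)

end ExteriorDerivative

/-! ### Contact triads, and the covariant derivative of the Reeb field. -/

namespace ContactTriad

open Set Filter
open scoped Topology

variable {F : Type*} [NormedAddCommGroup F] [NormedSpace ℝ F]
  {M : Type*} [TopologicalSpace M] [ChartedSpace F M] [IsManifold 𝓘(ℝ, F) ∞ M]
  (T : ContactTriad F M)

theorem proj_apply (p : M) (v : TangentSpace 𝓘(ℝ, F) p) :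
    T.proj p v = v - T.form p v • T.reeb p := rfl

theorem form_proj (p : M) (v : TangentSpace 𝓘(ℝ, F) p) : T.form p (T.proj p v) = 0 := by
  rw [proj_apply, map_sub, map_smul, T.form_reeb, smul_eq_mul, mul_one, sub_self]

theorem proj_eq_self {p : M} {v : TangentSpace 𝓘(ℝ, F) p} (hv : T.form p v = 0) :
    T.proj p v = v := by
  rw [proj_apply, hv, zero_smul, sub_zero]

theorem proj_reeb (p : M) : T.proj p (T.reeb p) = 0 := by
  rw [proj_apply, T.form_reeb, one_smul, sub_self]

theorem J_proj (p : M) (v : TangentSpace 𝓘(ℝ, F) p) : T.J p (T.proj p v) = T.J p v := by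
  rw [proj_apply, map_sub, map_smul, T.J_reeb, smul_zero, sub_zero]

theorem reeb_diffAt (p : M) : VectorFieldDiffAt 𝓘(ℝ, F) T.reeb p :=
  (T.smooth_reeb p).mdifferentiableAt (by simp)

theorem J_diffAt {Y : Π p : M, TangentSpace 𝓘(ℝ, F) p} {p : M}
    (hY : VectorFieldDiffAt 𝓘(ℝ, F) Y p) : VectorFieldDiffAt 𝓘(ℝ, F) (fun q => T.J q (Y q)) p :=
  ((T.smooth_J _).mdifferentiableAt (by simp)).comp p hY

variable [FiniteDimensional ℝ F]

theorem proj_diffAt {Y : Π p : M, TangentSpace 𝓘(ℝ, F) p} {p : M}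
    (hY : VectorFieldDiffAt 𝓘(ℝ, F) Y p) :
    VectorFieldDiffAt 𝓘(ℝ, F) (fun q => T.proj q (Y q)) p :=
  mdifferentiableAt_sub_section hY
    ((T.smooth_form.mdifferentiableAt_apply hY).smul_section (T.reeb_diffAt p))

/-- Both functions `λ(Y)` and `λ(Z)` are constant, so only the bracket term of `dλ` survives. The
constant is `1` for the Reeb field and `0` for horizontal fields. -/
theorem form_mlieBracket {Y Z : Π p : M, TangentSpace 𝓘(ℝ, F) p} {p : M}
    (hY : VectorFieldDiffAt 𝓘(ℝ, F) Y p) (hZ : VectorFieldDiffAt 𝓘(ℝ, F) Z p)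
    {c : ℝ} (hYc : ∀ q, T.form q (Y q) = c) (hZ0 : T.IsHorizontal Z) :
    T.form p (mlieBracket 𝓘(ℝ, F) Y Z p) = -dForm 𝓘(ℝ, F) T.form p (Y p) (Z p) := by
  rw [dForm_apply T.smooth_form hY hZ, dFormField]
  simp only [hYc, hZ0 _]
  rw [mvfderiv_const, mvfderiv_const]
  simp

variable {T} {cov : CovariantDerivative 𝓘(ℝ, F) F (TangentSpace 𝓘(ℝ, F) : M → Type _)}

theorem IsContactTriadConnection.mlieBracket_reeb (hcov : T.IsContactTriadConnection cov)
    {Y : Π p : M, TangentSpace 𝓘(ℝ, F) p} {p : M} (hY : VectorFieldDiffAt 𝓘(ℝ, F) Y p) :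
    mlieBracket 𝓘(ℝ, F) T.reeb Y p = cov Y p (T.reeb p) - cov T.reeb p (Y p) := by
  have : CompleteSpace F := FiniteDimensional.complete ℝ F
  have h := hcov.torsion_reeb p (Y p)
  rw [cov.torsion_apply (T.reeb_diffAt p) hY] at h
  exact (sub_eq_zero.1 h).symm

/-- The discarded part is `∇_R(λ(Y) R)`, a multiple of `R` because `∇_R R = 0`, and `J R = 0`. -/
theorem IsContactTriadConnection.J_cov_proj (hcov : T.IsContactTriadConnection cov)
    {Y : Π p : M, TangentSpace 𝓘(ℝ, F) p} {p : M} (hY : VectorFieldDiffAt 𝓘(ℝ, F) Y p) :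
    T.J p (cov (fun q => T.proj q (Y q)) p (T.reeb p)) = T.J p (cov Y p (T.reeb p)) := by
  have hf := T.smooth_form.mdifferentiableAt_apply hY
  have hR := T.reeb_diffAt p
  have hsum : Y = (fun q => T.proj q (Y q)) + (fun q => T.form q (Y q)) • T.reeb := by
    funext q
    exact (sub_add_cancel _ _).symm
  conv_rhs => rw [hsum]
  rw [cov.isCovariantDerivativeOn.add (T.proj_diffAt hY) (hf.smul_section hR),
    cov.isCovariantDerivativeOn.leibniz hR hf]
  simp [hcov.reeb_reeb, T.J_reeb]

/-- The covariant derivative of the Reeb field is `½ (L_R J) J` on the contact distribution. -/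
theorem IsContactTriadConnection.halfLieJJ_eq (hcov : T.IsContactTriadConnection cov) {p : M}
    {v : TangentSpace 𝓘(ℝ, F) p} (hv : T.form p v = 0) :
    halfLieJJ T p v = cov T.reeb p v := by
  set w := T.J p v with hw
  have hw0 : T.form p w = 0 := T.form_J p v
  set V : Π q : M, TangentSpace 𝓘(ℝ, F) q := extend F w with hVdef
  have hV : VectorFieldDiffAt 𝓘(ℝ, F) V p := extend_mdifferentiableAt w
  have hVp : V p = w := extend_apply_self F w
  have hJV := T.J_diffAt hV
  have h1 := hcov.mlieBracket_reeb hJV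
  have h2 := hcov.mlieBracket_reeb hV
  have h3 : T.form p (mlieBracket 𝓘(ℝ, F) T.reeb (fun q => T.J q (V q)) p) = 0 := by
    rw [T.form_mlieBracket (T.reeb_diffAt p) hJV T.form_reeb (fun q => T.form_J q _),
      T.dForm_reeb, neg_zero]
  -- The extension `V` need not be horizontal away from `p`, so `J`-linearity is applied to `Π V`;
  -- this changes neither `J V` nor `J ∇_R V`.
  have h4 := hcov.hermitian_J (fun q => T.proj q (V q)) p (T.reeb p)
    (fun q => T.form_proj q _) (T.proj_diffAt hV)
  simp only [T.J_proj] at h4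
  rw [hcov.J_cov_proj hV] at h4
  have hJJ : T.J p w = -v := T.J_sq p v hv
  have h5 : mlieBracket 𝓘(ℝ, F) T.reeb (fun q => T.J q (V q)) p =
      T.J p (cov V p (T.reeb p)) + cov T.reeb p v := by
    rw [← T.proj_eq_self h3, h1, map_sub, h4, hVp, hJJ, map_neg, map_neg,
      T.proj_eq_self (hcov.form_reeb p v hv), sub_neg_eq_add]
  have h6 : T.J p (cov T.reeb p w) = cov T.reeb p v := by
    have h := hcov.reeb_linear_part p v hv
    rw [smul_eq_zero_iff_right (by norm_num), sub_eq_zero] at h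
    exact h.symm
  -- With `w = Jv`, the terms `J ∇_R V` cancel in `[R, JV] - J[R, V]`. What remains is `∇_v R + J
  -- ∇_{Jv} R = 2 ∇_v R`, by the last axiom of the connection.
  rw [halfLieJJ, lieDerivEnd, ← hw, ← hVdef, h5, h2, map_sub, hVp, h6]
  module

/-- `T^π` vanishes on pairs `v`, `w` lying in a common `J`-complex line of `ξ`. -/
theorem IsContactTriadConnection.torsionPi_J_right (hcov : T.IsContactTriadConnection cov) {p : M}
    {v : TangentSpace 𝓘(ℝ, F) p} (hv : T.form p v = 0) :
    T.torsionPi cov p v (T.J p v) = 0 := by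
  have : CompleteSpace F := FiniteDimensional.complete ℝ F
  have h := hcov.torsion_J p v hv
  rw [torsionPi] at h ⊢
  rw [cov.torsion_antisymm, map_neg, h, neg_zero]

end ContactTriad

/-! ### Differentiability of the horizontal Hamiltonian field along the map. -/

section Hamiltonian

open Set Filter
open scoped Topology

variable {E : Type*} [NormedAddCommGroup E] [NormedSpace ℝ E]
  {B : Type*} [TopologicalSpace B] {I : ModelWithCorners ℝ E B}
  {S : Type*} [TopologicalSpace S] [ChartedSpace B S] [IsManifold I ∞ S]
  {F : Type*} [NormedAddCommGroup F] [NormedSpace ℝ F]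
  {M : Type*} [TopologicalSpace M] [ChartedSpace F M] [IsManifold 𝓘(ℝ, F) ∞ M]
  {u : S → M} {z : S}

/-- Near `z` the operators stay invertible, so `x = A⁻¹ c`, and inversion of operators is
differentiable. -/
theorem mdifferentiableAt_of_clm_apply_eventuallyEq {G : Type*} [NormedAddCommGroup G]
    [NormedSpace ℝ G] [CompleteSpace F] {A : S → F →L[ℝ] G} {x : S → F} {c : S → G}
    (hA : MDifferentiableAt I 𝓘(ℝ, F →L[ℝ] G) A z) (hinv : (A z).IsInvertible)
    (hc : MDifferentiableAt I 𝓘(ℝ, G) c z) (h : ∀ᶠ z' in 𝓝 z, A z' (x z') = c z') :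
    MDifferentiableAt I 𝓘(ℝ, F) x z := by
  obtain ⟨e, he⟩ := hinv
  have h1 : DifferentiableAt ℝ (ContinuousLinearMap.inverse : (F →L[ℝ] G) → _) (A z) := by
    rw [← he]
    exact (contDiffAt_map_inverse (n := 1) e).differentiableAt one_ne_zero
  have h2 := (h1.comp_mdifferentiableAt hA).clm_apply hc
  refine h2.congr_of_eventuallyEq ?_
  have h3 : ∀ᶠ z' in 𝓝 z, A z' ∈ range ((↑) : (F ≃L[ℝ] G) → F →L[ℝ] G) := by
    apply hA.continuousAt
    rw [← he]
    exact ContinuousLinearEquiv.nhds e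
  filter_upwards [h, h3] with z' hz' ⟨e', he'⟩
  rw [Function.comp_apply, ← hz', ← he', ContinuousLinearMap.inverse_equiv]
  exact (e'.symm_apply_apply _).symm

theorem mdifferentiableAt_pi_real {ι : Type*} [Fintype ι] {f : S → ι → ℝ}
    (hf : ∀ i, MDifferentiableAt I 𝓘(ℝ, ℝ) (fun z' => f z' i) z) :
    MDifferentiableAt I 𝓘(ℝ, ι → ℝ) f z := by
  refine ⟨(continuousAt_pi.2 fun i => (hf i).continuousAt).continuousWithinAt, ?_⟩
  exact differentiableWithinAt_pi.2 fun i => (hf i).2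

/-- Joint smoothness of `H` makes the coordinate expression of `d(H z')` at `u z'` differentiable in
`z'`; it is then paired with the components of `s`. -/
theorem mdifferentiableAt_mvfderiv_param {H : S → M → ℝ}
    (hH : ContMDiff (I.prod 𝓘(ℝ, F)) 𝓘(ℝ, ℝ) ∞ (fun q : S × M => H q.1 q.2))
    (hu : ContMDiff I 𝓘(ℝ, F) ∞ u) {s : Π z : S, TangentSpace 𝓘(ℝ, F) (u z)}
    (hs : AlongDiffAt I u s z) :
    MDifferentiableAt I 𝓘(ℝ, ℝ) (fun z' => mvfderiv 𝓘(ℝ, F) (H z') (u z') (s z')) z := by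
  have h1 : ContMDiffAt I 𝓘(ℝ, F →L[ℝ] ℝ) 1 _ z := ContMDiffAt.mfderiv (n := ∞) H u
    (hH (z, u z)) ((hu z).of_le (by norm_cast)) (by norm_cast)
  refine ((h1.mdifferentiableAt one_ne_zero).clm_apply hs).congr_of_eventuallyEq ?_
  filter_upwards [eventually_mem_baseSet (F := F) (hu z).continuousAt] with z' hz'
  set e := (trivializationAt F (TangentSpace 𝓘(ℝ, F) : M → Type _) (u z)).continuousLinearEquivAt ℝ
    (u z') hz' with he
  have hy : H z' (u z') ∈ (trivializationAt ℝ (TangentSpace 𝓘(ℝ, ℝ) : ℝ → Type _)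
      (H z (u z))).baseSet := by
    rw [TangentBundle.trivializationAt_baseSet, chartAt_self_eq]
    exact mem_univ _
  have h2 := ContinuousLinearMap.inCoordinates_eq (ϕ := mfderiv 𝓘(ℝ, F) 𝓘(ℝ, ℝ) (H z') (u z'))
    hz' hy
  have h3 := congrArg (fun L : F →L[ℝ] ℝ => L (coeffAlong u s z z')) h2
  have h4 : e.symm (coeffAlong u s z z') = s z' := e.symm_apply_apply (s z')
  refine Eq.trans ?_ h3.symm
  have h5 : ∀ t : TangentSpace 𝓘(ℝ, ℝ) (H z' (u z')),
      (trivializationAt ℝ (TangentSpace 𝓘(ℝ, ℝ) : ℝ → Type _) (H z (u z))).continuousLinearEquivAt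
        ℝ (H z' (u z')) hy t = t := fun t =>
    congrArg Prod.snd (trivializationAt_model_space_apply (I := 𝓘(ℝ, ℝ))
      (⟨H z' (u z'), t⟩ : TangentBundle 𝓘(ℝ, ℝ) ℝ) (H z (u z)))
  refine Eq.trans ?_ (h5 _).symm
  exact congrArg (mfderiv 𝓘(ℝ, F) 𝓘(ℝ, ℝ) (H z') (u z')) h4.symm

variable [FiniteDimensional ℝ F] {T : ContactTriad F M}

theorem ContactTriad.dForm_reeb_right (p : M) (v : TangentSpace 𝓘(ℝ, F) p) :
    dForm 𝓘(ℝ, F) T.form p v (T.reeb p) = 0 := by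
  have h : dForm 𝓘(ℝ, F) T.form p v (T.reeb p) = -dForm 𝓘(ℝ, F) T.form p (T.reeb p) v := by
    rw [dForm, dForm, mlieBracket_swap_apply, map_neg]
    ring
  rw [h, T.dForm_reeb, neg_zero]

theorem ContactTriad.dForm_proj (p : M) (v w : TangentSpace 𝓘(ℝ, F) p) :
    dForm 𝓘(ℝ, F) T.form p (T.proj p v) (T.proj p w) = dForm 𝓘(ℝ, F) T.form p v w := by
  have h1 := T.dForm_reeb p
  have h2 := T.dForm_reeb_right p
  simp only [dForm_eq_dFormHom T.smooth_form] at h1 h2 ⊢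
  simp [T.proj_apply, h1, h2]

/-- Evaluate `dλ` on `X` and a horizontal extension of `Π w`: the bracket term vanishes because `X`
is contact, `λ(Π w) = 0`, and `λ(X) = -h` leaves `dh(Π w)`. -/
theorem ContactTriad.IsContactHamiltonianVectorField.dForm_eq {h : M → ℝ}
    {X : Π p : M, TangentSpace 𝓘(ℝ, F) p} (hX : T.IsContactHamiltonianVectorField h X) (p : M)
    (w : TangentSpace 𝓘(ℝ, F) p) :
    dForm 𝓘(ℝ, F) T.form p (X p) w = mvfderiv 𝓘(ℝ, F) h p (T.proj p w) := by
  have hXd : VectorFieldDiffAt 𝓘(ℝ, F) X p := (hX.smooth p).mdifferentiableAt (by simp)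
  have hwd := T.proj_diffAt (extend_mdifferentiableAt w)
  have h1 := hX.contact (fun q => T.proj q (extend F w q)) p (fun q => T.form_proj q _) hwd
  have h2 := dForm_apply T.smooth_form hXd hwd
  have h3 : (fun q => T.form q (X q)) = -h := by
    funext q
    rw [Pi.neg_apply, ← hX.hamiltonian q, neg_neg]
  have h4 : dForm 𝓘(ℝ, F) T.form p (X p) (T.proj p w) = dForm 𝓘(ℝ, F) T.form p (X p) w := by
    rw [← T.dForm_proj p _ (T.proj p w), T.proj_eq_self (T.form_proj p w), T.dForm_proj]
  simp only [extend_apply_self] at h2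
  rw [← h4, h2, dFormField, h1, h3, mvfderiv_neg]
  simp only [T.form_proj, extend_apply_self]
  rw [mvfderiv_const]
  simp

/-- The bilinear form `dλ + λ ⊗ λ`. -/
def ContactTriad.pairing (T : ContactTriad F M) (p : M) :
    TangentSpace 𝓘(ℝ, F) p →L[ℝ] TangentSpace 𝓘(ℝ, F) p →L[ℝ] ℝ :=
  dFormHom T.smooth_form p + (T.form p).smulRight (T.form p)

theorem ContactTriad.pairing_apply (p : M) (v w : TangentSpace 𝓘(ℝ, F) p) :
    T.pairing p v w = dForm 𝓘(ℝ, F) T.form p v w + T.form p v * T.form p w := by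
  rw [dForm_eq_dFormHom T.smooth_form]
  rfl

/-- Testing against `R` gives `λ(v) = 0`; nondegeneracy of `dλ` on `ξ` does the rest. The summand `λ
⊗ λ` is there because `dλ` alone has kernel spanned by `R`. -/
theorem ContactTriad.pairing_nondegenerate (p : M) (v : TangentSpace 𝓘(ℝ, F) p)
    (h : ∀ w, T.pairing p v w = 0) : v = 0 := by
  have hv : T.form p v = 0 := by
    have := h (T.reeb p)
    rwa [pairing_apply, dForm_reeb_right, T.form_reeb, zero_add, mul_one] at this
  refine T.nondegenerate p v hv fun w _ => ?_
  have := h w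
  rwa [pairing_apply, hv, zero_mul, add_zero] at this

theorem ContactTriad.proj_contMDiffAt {Y : Π p : M, TangentSpace 𝓘(ℝ, F) p} {p : M}
    {n : WithTop ℕ∞} (hn : n ≤ ∞)
    (hY : ContMDiffAt 𝓘(ℝ, F) 𝓘(ℝ, F).tangent n (fun q => (⟨q, Y q⟩ : TangentBundle 𝓘(ℝ, F) M)) p) :
    ContMDiffAt 𝓘(ℝ, F) 𝓘(ℝ, F).tangent n
      (fun q => (⟨q, T.proj q (Y q)⟩ : TangentBundle 𝓘(ℝ, F) M)) p :=
  hY.sub_section ((((T.smooth_form _).of_le hn).comp p hY).smul_section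
    ((T.smooth_reeb p).of_le hn))

/-- `dForm` uses a different chart at each point, so its regularity is not visible from the
definition. On projected fields it equals `-λ([ΠY, ΠZ])`, and `C²` fields have a `C¹` bracket. -/
theorem ContactTriad.pairing_mdifferentiableAt {Y Z : Π p : M, TangentSpace 𝓘(ℝ, F) p} {p : M}
    (hY : ContMDiffAt 𝓘(ℝ, F) 𝓘(ℝ, F).tangent 2 (fun q => (⟨q, Y q⟩ : TangentBundle 𝓘(ℝ, F) M)) p)
    (hZ : ContMDiffAt 𝓘(ℝ, F) 𝓘(ℝ, F).tangent 2
      (fun q => (⟨q, Z q⟩ : TangentBundle 𝓘(ℝ, F) M)) p) :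
    MDifferentiableAt 𝓘(ℝ, F) 𝓘(ℝ, ℝ) (fun q => T.pairing q (Y q) (Z q)) p := by
  have : CompleteSpace F := FiniteDimensional.complete ℝ F
  have : IsManifold 𝓘(ℝ, F) 3 M := .of_le (n := ∞) (by norm_cast)
  have hY' := T.proj_contMDiffAt (by norm_cast) hY
  have hZ' := T.proj_contMDiffAt (by norm_cast) hZ
  have : IsManifold 𝓘(ℝ, F) (((2 : ℕ∞) : WithTop ℕ∞) + 1) M := by norm_num; infer_instance
  have : IsManifold 𝓘(ℝ, F) (minSmoothness ℝ 2) M := by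
    rw [minSmoothness_of_isRCLikeNormedField]
    exact .of_le (n := ∞) (by norm_cast)
  have : IsManifold 𝓘(ℝ, F) (minSmoothness ℝ 3) M := by
    rw [minSmoothness_of_isRCLikeNormedField]
    infer_instance
  have hbr := (ContMDiffAt.mlieBracket_vectorField (n := 2) (m := 1) hY' hZ' (by norm_num)).mdifferentiableAt one_ne_zero
  have h1 := T.smooth_form.mdifferentiableAt_apply hbr
  have h2 := (T.smooth_form.mdifferentiableAt_apply (hY.mdifferentiableAt two_ne_zero)).mul
    (T.smooth_form.mdifferentiableAt_apply (hZ.mdifferentiableAt two_ne_zero))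
  refine (h1.neg.add h2).congr_of_eventuallyEq ?_
  filter_upwards [(contMDiffAt_iff_contMDiffAt_nhds (by simp)).1 hY',
    (contMDiffAt_iff_contMDiffAt_nhds (by simp)).1 hZ'] with q hq hq'
  have h3 := T.form_mlieBracket (c := 0) (hq.mdifferentiableAt two_ne_zero)
    (hq'.mdifferentiableAt two_ne_zero) (fun q => T.form_proj q _) (fun q => T.form_proj q _)
  rw [T.pairing_apply]
  simp only [Pi.add_apply, Pi.neg_apply, Pi.mul_apply]
  rw [h3, T.dForm_proj, neg_neg]

/-- The projection of a Hamiltonian vector field along `u` is differentiable. -/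
theorem alongDiffAt_horizontalAlong {H : S → M → ℝ}
    (hH : ContMDiff (I.prod 𝓘(ℝ, F)) 𝓘(ℝ, ℝ) ∞ (fun q : S × M => H q.1 q.2))
    {X : S → Π p : M, TangentSpace 𝓘(ℝ, F) p}
    (hX : ∀ z, T.IsContactHamiltonianVectorField (H z) (X z))
    (hu : ContMDiff I 𝓘(ℝ, F) ∞ u) : AlongDiffAt I u (horizontalAlong T u X) z := by
  have : CompleteSpace F := FiniteDimensional.complete ℝ F
  let b := Module.finBasis ℝ F
  let e : Fin (Module.finrank ℝ F) → Π p : M, TangentSpace 𝓘(ℝ, F) p :=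
    fun i => extend F ((tangentCoord (u z)).symm (b i))
  have he : ∀ i, ContMDiffAt 𝓘(ℝ, F) 𝓘(ℝ, F).tangent 2
      (fun q => (⟨q, e i q⟩ : TangentBundle 𝓘(ℝ, F) M)) (u z) := fun i => by
    have : ContMDiffVectorBundle 2 F (TangentSpace 𝓘(ℝ, F) : M → Type _) 𝓘(ℝ, F) := by
      have : IsManifold 𝓘(ℝ, F) (2 + 1) M := .of_le (n := ∞) (by norm_cast)
      exact TangentBundle.contMDiffVectorBundle
    exact contMDiffAt_extend _ _ _
  have hez : ∀ i, e i (u z) = (tangentCoord (u z)).symm (b i) := fun i => extend_apply_self F _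
  have hu' := (hu z).mdifferentiableAt (by simp)
  -- The Gram operator of `pairing` in the local frame `e`, which has constant coordinates in the
  -- trivialization at `u z`. The components of `X_H^π(u)` will solve `A x = c`.
  let A : S → F →L[ℝ] (Fin (Module.finrank ℝ F) → ℝ) := fun z' =>
    ∑ i, ContinuousLinearMap.smulRightL ℝ F (Fin (Module.finrank ℝ F) → ℝ)
      (LinearMap.toContinuousLinearMap (b.coord i))
      (fun j => T.pairing (u z') (e i (u z')) (e j (u z')))
  have hA_apply : ∀ z' x j, A z' x j = T.pairing (u z') (∑ i, b.repr x i • e i (u z')) (e j (u z')) := by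
    intro z' x j
    simp [A]
  have hA : MDifferentiableAt I 𝓘(ℝ, F →L[ℝ] (Fin (Module.finrank ℝ F) → ℝ)) A z := by
    have hA' : A = ∑ i, (fun z' => ContinuousLinearMap.smulRightL ℝ F
        (Fin (Module.finrank ℝ F) → ℝ) (LinearMap.toContinuousLinearMap (b.coord i))
        (fun j => T.pairing (u z') (e i (u z')) (e j (u z')))) := by
      funext z'
      simp only [A, Finset.sum_apply]
    rw [hA']
    refine MDifferentiableAt.sum fun i _ => ?_
    exact (ContinuousLinearMap.differentiable _).comp_mdifferentiableAt
      (mdifferentiableAt_pi_real fun j =>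
        (T.pairing_mdifferentiableAt (he i) (he j)).comp z hu')
  refine mdifferentiableAt_of_clm_apply_eventuallyEq hA ?_
    (c := fun z' j => mvfderiv 𝓘(ℝ, F) (H z') (u z') (T.proj (u z') (e j (u z')))) ?_ ?_
  · have hinj : Function.Injective (A z) := by
      rw [injective_iff_map_eq_zero]
      intro x hx
      have hsum : ∑ i, b.repr x i • e i (u z) = (tangentCoord (u z)).symm x := by
        simp only [hez, ← map_smul, ← map_sum, b.sum_repr]
      have h0 : (tangentCoord (u z)).symm x = 0 := by
        refine T.pairing_nondegenerate (u z) _ fun w => ?_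
        have hw : w = ∑ j, b.repr (tangentCoord (u z) w) j • e j (u z) := by
          simp only [hez, ← map_smul, ← map_sum, b.sum_repr,
            ContinuousLinearEquiv.symm_apply_apply]
        rw [hw, map_sum]
        refine Finset.sum_eq_zero fun j _ => ?_
        rw [map_smul, ← hsum, ← hA_apply, hx, Pi.zero_apply, smul_zero]
      simpa using h0
    exact ⟨(LinearEquiv.ofInjectiveOfFinrankEq (A z : F →ₗ[ℝ] _) hinj (by simp)).toContinuousLinearEquiv, by ext; rfl⟩
  · refine mdifferentiableAt_pi_real fun j => ?_
    exact mdifferentiableAt_mvfderiv_param hH hu (alongDiffAt_comp hu'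
      (T.proj_diffAt ((he j).mdifferentiableAt two_ne_zero)))
  · filter_upwards [eventually_mem_baseSet (F := F) (hu z).continuousAt] with z' hz'
    funext j
    have hsum : ∑ i, b.repr (coeffAlong u (horizontalAlong T u X) z z') i • e i (u z') = 
        horizontalAlong T u X z' := by
      have h1 : ∀ i, e i (u z') = (trivializationAt F (TangentSpace 𝓘(ℝ, F) : M → Type _)
          (u z)).symmₗ ℝ (u z') (b i) := fun i => by
        rw [← (tangentCoord (u z)).apply_symm_apply (b i)]
        exact extend_eq _ hz'
      simp only [h1, ← map_smul, ← map_sum, b.sum_repr]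
      have h2 := (trivializationAt F (TangentSpace 𝓘(ℝ, F) : M → Type _) (u z)).symmₗ_linearMapAt
        (R := ℝ) hz' (horizontalAlong T u X z')
      rwa [Bundle.Trivialization.linearMapAt_apply, if_pos hz'] at h2
    -- The term `λ ⊗ λ` drops out since the field is horizontal, and `dλ(ΠX, e j) = dλ(X, e j) =
    -- dH(Π e j)`.
    rw [hA_apply, hsum, T.pairing_apply, horizontalAlong, T.form_proj, zero_mul, add_zero,
      ← T.dForm_proj, T.proj_eq_self (T.form_proj _ _), T.dForm_proj, (hX z').dForm_eq]

end Hamiltonian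

/-! ### Cauchy-Riemann input, projected derivatives and the final assembly. -/

section FundamentalEquation

variable {E : Type*} [NormedAddCommGroup E] [NormedSpace ℝ E]
  {B : Type*} [TopologicalSpace B] {I : ModelWithCorners ℝ E B}
  {S : Type*} [TopologicalSpace S] [ChartedSpace B S] [IsManifold I ∞ S]
  {F : Type*} [NormedAddCommGroup F] [NormedSpace ℝ F] [FiniteDimensional ℝ F]
  {M : Type*} [TopologicalSpace M] [ChartedSpace F M] [IsManifold 𝓘(ℝ, F) ∞ M]
  {T : ContactTriad F M}
  {cov : CovariantDerivative 𝓘(ℝ, F) F (TangentSpace 𝓘(ℝ, F) : M → Type _)}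
  {u : S → M} {z : S}

theorem SmoothOneForm.mdifferentiableAt_apply_field {γ : Π z : S, TangentSpace I z →L[ℝ] ℝ}
    (hγ : SmoothOneForm I γ) {W : Π z : S, TangentSpace I z} (hW : VectorFieldDiffAt I W z) :
    MDifferentiableAt I 𝓘(ℝ, ℝ) (fun z' => γ z' (W z')) z :=
  ((hγ _).mdifferentiableAt (by simp)).comp z hW

/-- A relation `j v = a v` would force `a² = -1`, so `v` and `j v` are independent and span the
plane. -/
theorem exists_eq_smul_add_smul_of_sq_eq_neg {V : Type*} [AddCommGroup V] [Module ℝ V]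
    (hV : Module.finrank ℝ V = 2) (j : V → V) (hj : ∀ (c : ℝ) v, j (c • v) = c • j v)
    (hsq : ∀ v, j (j v) = -v) {v : V} (hv : v ≠ 0) (w : V) :
    ∃ a b : ℝ, w = a • v + b • j v := by
  have hli : LinearIndependent ℝ ![v, j v] := by
    rw [LinearIndependent.pair_iff' hv]
    intro a ha
    have h1 : (a * a + 1) • v = 0 := by
      rw [add_smul, mul_smul, ha, ← hj, ha, hsq, one_smul, neg_add_cancel]
    rcases smul_eq_zero.1 h1 with h | h
    · nlinarith [mul_self_nonneg a]
    · exact hv h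
  have : FiniteDimensional ℝ V := Module.finite_of_finrank_pos (by omega)
  have hspan := hli.span_eq_top_of_card_eq_finrank' (by simp [hV])
  have hw : w ∈ Submodule.span ℝ (Set.range ![v, j v]) := hspan ▸ Submodule.mem_top
  rw [Matrix.range_cons, Matrix.range_cons, Matrix.range_empty, Set.union_empty,
    Set.singleton_union, Submodule.mem_span_pair] at hw
  obtain ⟨a, b, h⟩ := hw
  exact ⟨a, b, h.symm⟩

theorem form_dHPi (X : S → Π p : M, TangentSpace 𝓘(ℝ, F) p)
    (γ : Π z : S, TangentSpace I z →L[ℝ] ℝ) (v : TangentSpace I z) :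
    T.form (u z) (dHPi I T u X γ z v) = 0 :=
  T.form_proj _ _

/-- `Π du = d_H^π u + X_H^π(u) ⊗ γ`. -/
theorem dHPi_add_tensorForm (X : S → Π p : M, TangentSpace 𝓘(ℝ, F) p)
    (γ : Π z : S, TangentSpace I z →L[ℝ] ℝ) (v : TangentSpace I z) :
    dHPi I T u X γ z v + γ z v • horizontalAlong T u X z =
      T.proj (u z) (mfderiv I 𝓘(ℝ, F) u z v) := by
  have h : dHPi I T u X γ z v =
      T.proj (u z) (mfderiv I 𝓘(ℝ, F) u z v - γ z v • X z (u z)) := rfl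
  rw [h, map_sub, map_smul, horizontalAlong, sub_add_cancel]

theorem IsPerturbedCR.dHPi_j {j : AlmostComplexStructure I S}
    {X : S → Π p : M, TangentSpace 𝓘(ℝ, F) p} {γ : Π z : S, TangentSpace I z →L[ℝ] ℝ}
    (hCR : IsPerturbedCR I T j u X γ) (v : TangentSpace I z) :
    dHPi I T u X γ z (j.j z v) = T.J (u z) (dHPi I T u X γ z v) := by
  have h := hCR z v
  rw [smul_eq_zero_iff_right (by norm_num)] at h
  have h' := congrArg (T.J (u z)) h
  rw [map_add, map_zero, T.J_sq _ _ (form_dHPi X γ _), ← sub_eq_add_neg, sub_eq_zero] at h'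
  exact h'.symm

/-- `T^π(d_H^π u, d_H^π u) = 0` for a perturbed contact Cauchy-Riemann map. -/
theorem IsPerturbedCR.torsionPi_dHPi (hE : Module.finrank ℝ E = 2)
    (hcov : T.IsContactTriadConnection cov) {j : AlmostComplexStructure I S}
    {X : S → Π p : M, TangentSpace 𝓘(ℝ, F) p} {γ : Π z : S, TangentSpace I z →L[ℝ] ℝ}
    (hCR : IsPerturbedCR I T j u X γ) (v w : TangentSpace I z) :
    T.torsionPi cov (u z) (dHPi I T u X γ z v) (dHPi I T u X γ z w) = 0 := by
  have : CompleteSpace F := FiniteDimensional.complete ℝ F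
  rcases eq_or_ne v 0 with rfl | hv
  · simp [ContactTriad.torsionPi]
  obtain ⟨a, b, rfl⟩ := exists_eq_smul_add_smul_of_sq_eq_neg (V := TangentSpace I z) hE (j.j z)
    (fun c v => map_smul _ c v) (j.sq z) hv w
  -- Writing `w = a v + b j v` and moving `j` to `J` by the Cauchy-Riemann equation, the `a` part
  -- vanishes by antisymmetry and the `b` part is `T^π(Y, JY)` with `Y = d_H^π u (v)`.
  have h := hcov.torsionPi_J_right (form_dHPi (T := T) (u := u) X γ v)
  rw [ContactTriad.torsionPi] at h ⊢
  rw [map_add, map_smul, map_smul, hCR.dHPi_j, map_add, map_smul, map_smul, map_add, map_smul,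
    map_smul, h, cov.torsion_self, map_zero, smul_zero, smul_zero, add_zero]

theorem ContactTriad.mdifferentiableAt_form_along (hu : MDifferentiableAt I 𝓘(ℝ, F) u z)
    {s : Π z : S, TangentSpace 𝓘(ℝ, F) (u z)} (hs : AlongDiffAt I u s z) :
    MDifferentiableAt I 𝓘(ℝ, ℝ) (fun z' => T.form (u z') (s z')) z :=
  ((T.smooth_form _).mdifferentiableAt (by simp)).comp z ((alongDiffAt_iff hu).1 hs)

theorem ContactTriad.proj_along_eq (s : Π z : S, TangentSpace 𝓘(ℝ, F) (u z)) :
    (fun z' => T.proj (u z') (s z')) =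
      s + (fun z' => -T.form (u z') (s z')) • fun z' => T.reeb (u z') := by
  funext z'
  rw [T.proj_apply, sub_eq_add_neg, ← neg_smul]
  rfl

theorem ContactTriad.alongDiffAt_proj (hu : MDifferentiableAt I 𝓘(ℝ, F) u z)
    {s : Π z : S, TangentSpace 𝓘(ℝ, F) (u z)} (hs : AlongDiffAt I u s z) :
    AlongDiffAt I u (fun z' => T.proj (u z') (s z')) z := by
  rw [T.proj_along_eq s]
  exact hs.add hu.continuousAt (.smul hu.continuousAt (T.mdifferentiableAt_form_along hu hs).neg
    (alongDiffAt_comp hu (T.reeb_diffAt _)))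

/-- Apply the Leibniz rule to `Π s = s - λ(s) R`; the derivative of `λ(s)` multiplies `R` and
disappears under `Π`. -/
theorem ContactTriad.pullbackCovPi_proj (hu : MDifferentiableAt I 𝓘(ℝ, F) u z)
    {s : Π z : S, TangentSpace 𝓘(ℝ, F) (u z)} (hs : AlongDiffAt I u s z) (v : TangentSpace I z) :
    pullbackCovPi I T cov u (fun z' => T.proj (u z') (s z')) z v =
      T.proj (u z) (pullbackCov I cov u s z v)
        - T.form (u z) (s z) • T.proj (u z) (cov T.reeb (u z) (mfderiv I 𝓘(ℝ, F) u z v)) := by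
  have hR := alongDiffAt_comp hu (T.reeb_diffAt (u z))
  have hf : MDifferentiableAt I 𝓘(ℝ, ℝ) (fun z' => -T.form (u z') (s z')) z :=
    (T.mdifferentiableAt_form_along hu hs).neg
  rw [pullbackCovPi, T.proj_along_eq s, pullbackCov_add cov hu.continuousAt hs
    (.smul hu.continuousAt hf hR), pullbackCov_smul cov hu.continuousAt hf hR,
    pullbackCov_comp cov hu (T.reeb_diffAt _), map_add, map_add, map_smul, map_smul, T.proj_reeb,
    smul_zero, add_zero, neg_smul, sub_eq_add_neg]

theorem ContactTriad.IsContactTriadConnection.proj_cov_reeb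
    (hcov : T.IsContactTriadConnection cov) {p : M} (v : TangentSpace 𝓘(ℝ, F) p) :
    T.proj p (cov T.reeb p v) = cov T.reeb p (T.proj p v) := by
  have h : cov T.reeb p v = cov T.reeb p (T.proj p v) := by
    rw [T.proj_apply, map_sub, map_smul, hcov.reeb_reeb, smul_zero, sub_zero]
  rw [h, T.proj_eq_self (hcov.form_reeb p _ (T.form_proj p v))]

theorem ContactTriad.IsContactTriadConnection.torsion_proj
    (hcov : T.IsContactTriadConnection cov) {p : M} (v w : TangentSpace 𝓘(ℝ, F) p) :
    cov.torsion p (T.proj p v) (T.proj p w) = cov.torsion p v w := by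
  have : CompleteSpace F := FiniteDimensional.complete ℝ F
  have h : ∀ v, cov.torsion p v (T.reeb p) = 0 := fun v => by
    rw [cov.torsion_antisymm, hcov.torsion_reeb, neg_zero]
  simp [T.proj_apply, h, hcov.torsion_reeb]

end FundamentalEquation

theorem fundamental_equation
    {E : Type*} [NormedAddCommGroup E] [NormedSpace ℝ E] (hE : Module.finrank ℝ E = 2)
    {B : Type*} [TopologicalSpace B] (I : ModelWithCorners ℝ E B)
    {S : Type*} [TopologicalSpace S] [ChartedSpace B S] [IsManifold I ∞ S]
    {F : Type*} [NormedAddCommGroup F] [NormedSpace ℝ F] [FiniteDimensional ℝ F]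
    {M : Type*} [TopologicalSpace M] [ChartedSpace F M] [IsManifold 𝓘(ℝ, F) ∞ M]
    -- the surface `(S, j)`, possibly with boundary, and the contact triad with its connection
    (j : ContactCR.AlmostComplexStructure I S) (T : ContactCR.ContactTriad F M)
    (cov : CovariantDerivative 𝓘(ℝ, F) F (TangentSpace 𝓘(ℝ, F) : M → Type _))
    (hcov : T.IsContactTriadConnection cov)
    -- the one-form `γ`, the Hamiltonian `H` and the vector fields `X z = X_{H(z, ·)}`
    (γ : Π z : S, TangentSpace I z →L[ℝ] ℝ) (hγ : ContactCR.SmoothOneForm I γ)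
    (H : S → M → ℝ)
    (hH : ContMDiff (I.prod 𝓘(ℝ, F)) 𝓘(ℝ, ℝ) ∞ (fun q : S × M => H q.1 q.2))
    (X : S → Π p : M, TangentSpace 𝓘(ℝ, F) p)
    (hX : ∀ z, T.IsContactHamiltonianVectorField (H z) (X z))
    -- the perturbed contact Cauchy-Riemann map
    (u : S → M) (hu : ContMDiff I 𝓘(ℝ, F) ∞ u) (hCR : ContactCR.IsPerturbedCR I T j u X γ)
    -- evaluation of two-forms on vector fields `V`, `W` at a point
    (z : S) (V W : Π z : S, TangentSpace I z)
    (hV : ContactCR.VectorFieldDiffAt I V z) (hW : ContactCR.VectorFieldDiffAt I W z) :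
    ContactCR.extCovDerivPi I T cov u (ContactCR.dHPi I T u X γ) V W z
      = ContactCR.wedge (ContactCR.pullbackForm I T u z)
          (fun v => ContactCR.halfLieJJ T (u z) (ContactCR.dHPi I T u X γ z v)) (V z) (W z)
        + T.torsionPi cov (u z) (ContactCR.horizontalAlong T u X z)
          (ContactCR.wedge (γ z) (ContactCR.dHPi I T u X γ z) (V z) (W z))
        + ContactCR.wedge (ContactCR.pullbackForm I T u z)
          (fun v => ContactCR.halfLieJJ T (u z)
            (ContactCR.tensorForm I (ContactCR.horizontalAlong T u X) γ z v)) (V z) (W z)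
        - ContactCR.extCovDerivPi I T cov u
          (ContactCR.tensorForm I (ContactCR.horizontalAlong T u X) γ) V W z := by
  have : FiniteDimensional ℝ E := Module.finite_of_finrank_pos (by omega)
  have : CompleteSpace E := FiniteDimensional.complete ℝ E
  have : CompleteSpace F := FiniteDimensional.complete ℝ F
  have hud := (hu z).mdifferentiableAt (by simp : (∞ : WithTop ℕ∞) ≠ 0)
  have hXd : AlongDiffAt I u (horizontalAlong T u X) z := alongDiffAt_horizontalAlong hH hX hu
  -- the sum of the two exterior covariant derivatives is that of `Π du`
  have hsplit : ∀ (U : Π z : S, TangentSpace I z) (v : TangentSpace I z),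
      VectorFieldDiffAt I U z →
      pullbackCovPi I T cov u (fun z' => dHPi I T u X γ z' (U z')) z v
        + pullbackCovPi I T cov u
          (fun z' => tensorForm I (horizontalAlong T u X) γ z' (U z')) z v
      = T.proj (u z) (pullbackCov I cov u (fun z' => mfderiv I 𝓘(ℝ, F) u z' (U z')) z v)
        - T.form (u z) (mfderiv I 𝓘(ℝ, F) u z (U z)) •
          cov T.reeb (u z) (T.proj (u z) (mfderiv I 𝓘(ℝ, F) u z v)) := by
    intro U v hU
    have hdu := alongDiffAt_mfderiv hu hU
    have hγU := hγ.mdifferentiableAt_apply_field hU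
    have ht : AlongDiffAt I u (fun z' => tensorForm I (horizontalAlong T u X) γ z' (U z')) z :=
      AlongDiffAt.smul hud.continuousAt hγU hXd
    have hn : AlongDiffAt I u ((fun z' => -γ z' (U z')) • horizontalAlong T u X) z :=
      AlongDiffAt.smul hud.continuousAt hγU.neg hXd
    -- Differentiability of `d_H^π u (U)` is obtained from that of `Π du(U)` and `X_H^π(u)`, not
    -- from the fields `X z` themselves.
    have hβ : (fun z' => dHPi I T u X γ z' (U z')) =
        (fun z' => T.proj (u z') (mfderiv I 𝓘(ℝ, F) u z' (U z'))) +
          (fun z' => -γ z' (U z')) • horizontalAlong T u X := by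
      funext z'
      have h := dHPi_add_tensorForm (T := T) (u := u) X γ (U z')
      simp only [Pi.add_apply, Pi.smul_apply', neg_smul]
      rw [← h]
      abel
    have hβd : AlongDiffAt I u (fun z' => dHPi I T u X γ z' (U z')) z := by
      rw [hβ]
      exact (T.alongDiffAt_proj hud hdu).add hud.continuousAt hn
    have hsum : (fun z' => T.proj (u z') (mfderiv I 𝓘(ℝ, F) u z' (U z'))) =
        (fun z' => dHPi I T u X γ z' (U z')) +
          fun z' => tensorForm I (horizontalAlong T u X) γ z' (U z') := by
      funext z'
      exact (dHPi_add_tensorForm (T := T) (u := u) X γ (U z')).symm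
    rw [← hcov.proj_cov_reeb, ← T.pullbackCovPi_proj hud hdu, hsum]
    simp only [pullbackCovPi]
    rw [pullbackCov_add cov hud.continuousAt hβd ht, map_add]
  have hVW := hsplit W (V z) hW
  have hWV := hsplit V (W z) hV
  have htor := congrArg (T.proj (u z)) (pullbackCov_mfderiv_sub cov hu hV hW)
  rw [map_sub, map_add, ← hcov.torsion_proj] at htor
  have hbr := dHPi_add_tensorForm (T := T) (u := u) X γ (mlieBracket I V W z)
  have hv := dHPi_add_tensorForm (T := T) (u := u) X γ (V z)
  have hw := dHPi_add_tensorForm (T := T) (u := u) X γ (W z)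
  have hT := hCR.torsionPi_dHPi hE hcov (V z) (W z)
  have hhalf : ∀ v : TangentSpace I z, halfLieJJ T (u z) (dHPi I T u X γ z v)
      = cov T.reeb (u z) (dHPi I T u X γ z v) := fun v => hcov.halfLieJJ_eq (form_dHPi X γ v)
  have hhalf' : ∀ v : TangentSpace I z,
      halfLieJJ T (u z) (tensorForm I (horizontalAlong T u X) γ z v)
      = γ z v • cov T.reeb (u z) (horizontalAlong T u X z) := fun v => by
    have h : T.form (u z) (tensorForm I (horizontalAlong T u X) γ z v) = 0 := by
      change T.form (u z) (γ z v • horizontalAlong T u X z) = 0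
      rw [map_smul, horizontalAlong, T.form_proj, smul_zero]
    rw [hcov.halfLieJJ_eq h]
    exact map_smul _ _ _
  -- Expand both slots as `d_H^π u + γ X_H^π(u)`. The two pure terms vanish, and antisymmetry
  -- combines the mixed ones into a wedge with `γ`.
  have hexp : T.proj (u z) (cov.torsion (u z) (T.proj (u z) (mfderiv I 𝓘(ℝ, F) u z (V z)))
      (T.proj (u z) (mfderiv I 𝓘(ℝ, F) u z (W z)))) =
      T.torsionPi cov (u z) (horizontalAlong T u X z)
        (wedge (γ z) (dHPi I T u X γ z) (V z) (W z)) := by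
    rw [← hv, ← hw, wedge]
    rw [ContactTriad.torsionPi] at hT ⊢
    simp only [map_add, map_sub, map_smul, add_apply, smul_apply, cov.torsion_self, hT]
    rw [cov.torsion_antisymm (dHPi I T u X γ z (V z))]
    simp only [map_neg, smul_zero, map_zero]
    module
  rw [hexp] at htor
  rw [← hv, map_add, map_smul] at hVW
  rw [← hw, map_add, map_smul] at hWV
  rw [← hbr] at htor
  simp only [extCovDerivPi]
  simp only [wedge, hhalf, hhalf', pullbackForm, du]
  simp only [wedge] at htor
  have ht : ∀ v : TangentSpace I z, tensorForm I (horizontalAlong T u X) γ z v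
    = γ z v • horizontalAlong T u X z := fun _ => rfl
  rw [ht]
  -- Antisymmetrizing the derivative of `Π du` in `V`, `W` gives the `u^*λ` terms; the torsion
  -- identity replaces the rest and accounts for the bracket terms.
  linear_combination (norm := module) hVW - hWV + htor

end ContactCR

end

theorem mainTheorem6
    {E : Type*} [NormedAddCommGroup E] [NormedSpace ℝ E] (hE : Module.finrank ℝ E = 2)
    {B : Type*} [TopologicalSpace B] (I : ModelWithCorners ℝ E B)
    {S : Type*} [TopologicalSpace S] [ChartedSpace B S] [IsManifold I ∞ S]
    {F : Type*} [NormedAddCommGroup F] [NormedSpace ℝ F] [FiniteDimensional ℝ F]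
    {M : Type*} [TopologicalSpace M] [ChartedSpace F M] [IsManifold 𝓘(ℝ, F) ∞ M]
    -- the surface `(S, j)`, possibly with boundary, and the contact triad with its connection
    (j : ContactCR.AlmostComplexStructure I S) (T : ContactCR.ContactTriad F M)
    (cov : CovariantDerivative 𝓘(ℝ, F) F (TangentSpace 𝓘(ℝ, F) : M → Type _))
    (hcov : T.IsContactTriadConnection cov)
    -- the one-form `γ`, the Hamiltonian `H` and the vector fields `X z = X_{H(z, ·)}`
    (γ : Π z : S, TangentSpace I z →L[ℝ] ℝ) (hγ : ContactCR.SmoothOneForm I γ)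
    (H : S → M → ℝ)
    (hH : ContMDiff (I.prod 𝓘(ℝ, F)) 𝓘(ℝ, ℝ) ∞ (fun q : S × M => H q.1 q.2))
    (X : S → Π p : M, TangentSpace 𝓘(ℝ, F) p)
    (hX : ∀ z, T.IsContactHamiltonianVectorField (H z) (X z))
    -- the perturbed contact Cauchy-Riemann map
    (u : S → M) (hu : ContMDiff I 𝓘(ℝ, F) ∞ u) (hCR : ContactCR.IsPerturbedCR I T j u X γ)
    -- evaluation of two-forms on vector fields `V`, `W` at a point
    (z : S) (V W : Π z : S, TangentSpace I z)
    (hV : ContactCR.VectorFieldDiffAt I V z) (hW : ContactCR.VectorFieldDiffAt I W z) :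
    ContactCR.extCovDerivPi I T cov u (ContactCR.dHPi I T u X γ) V W z
      = ContactCR.wedge (ContactCR.pullbackForm I T u z)
          (fun v => ContactCR.halfLieJJ T (u z) (ContactCR.dHPi I T u X γ z v)) (V z) (W z)
        + T.torsionPi cov (u z) (ContactCR.horizontalAlong T u X z)
          (ContactCR.wedge (γ z) (ContactCR.dHPi I T u X γ z) (V z) (W z))
        + ContactCR.wedge (ContactCR.pullbackForm I T u z)
          (fun v => ContactCR.halfLieJJ T (u z)
            (ContactCR.tensorForm I (ContactCR.horizontalAlong T u X) γ z v)) (V z) (W z)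
        - ContactCR.extCovDerivPi I T cov u
          (ContactCR.tensorForm I (ContactCR.horizontalAlong T u X) γ) V W z :=
  ContactCR.fundamental_equation hE I j T cov hcov γ hγ H hH X hX u hu hCR z V W hV hW
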